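/- **Setup.** Let $k$ be a field and let $q\in k^\times$ not be a root of unity (that is, $q^n\neq 1$ for all $n\ge 1$). Let $H=k_q[x,x^{-1},y]$ be the $k$-algebra generated by $x,x^{-1},y$ with relations $xx^{-1}=x^{-1}x=1$, $yx=qxy$. It is a bialgebra with $\Delta(x^{\pm1})=x^{\pm1}\otimes x^{\pm1}$, $\Delta(y)=y\otimes x+1\otimes y$, $\varepsilon(x^{\pm1})=1$, $\varepsilon(y)=0$, and $\{x^ny^m\mid n\in\mathbb Z,\ m\ge 0\}$ is a $k$-basis of $H$. Let $\mathrm{Aut}_c(H)$ be the group of coalgebra automorphisms of $H$ under composition, $\mathrm{Aut}_0(H)=\{\phi\in\mathrm{Aut}_c(H)\mid\phi(1)=1\}$, and let $\mathrm{Aut}_*(H)$ be the set of those $\phi\in\mathrm{Aut}_0(H)$ for which there are $\beta_n\in k$ with $\phi(x^ny)=x^ny+\beta_n(x^{n+1}-x^n)$ for all $n\in\mathbb Z$. For $r\in\mathbb Z$, $\alpha\in(k^\times)^{\mathbb Z}$, $\beta\in k^{\mathbb Z}$ and $s\ge1$ define linear maps $H\to H$ on the basis by $$\theta_r(x^ny^m)=x^{n+r}y^m,\qquad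 \phi_\alpha(x^ny^m)=\Big(\prod_{i=0}^{m-1}\alpha_{n+i}\Big)x^ny^m,$$ $$\phi^{(s)}_\beta(x^ny^m)=x^ny^m+\sum_{1\le i\le m/s}\binom{m}{s}_{q,i}\big(\beta_{n,s;i}\,x^{n+is}-\beta_{n,s;i-1}\,\beta_{n+m-s}\,x^{n+(i-1)s}\big)y^{m-is},$$ where $\beta_{n,s;i}=\prod_{j=0}^{i-1}\beta_{n+js}$ and $\binom{m}{s}_{q,i}=\prod_{j=0}^{i-1}\binom{m-js}{s}_q$ with the $q$-binomial coefficients given by $\binom n0_q=\binom nn_q=1$ and $\binom ni_q=q^i\binom{n-1}{i}_q+\binom{n-1}{i-1}_q$ for $0<i<n$. Let $G_\infty$ be the set of sequences $(\beta^{(1)},\beta^{(2)},\dots)$ with $\beta^{(i)}\in k^{\mathbb Z}$, and for $g=(\beta^{(i)})_{i\ge1}\in G_\infty$ let $\Phi(g):H\to H$ be the linear map with $$\Phi(g)(x^ny^m)=\phi^{(1)}_{\beta^{(1)}}\cdots\phi^{(m)}_{\beta^{(m)}}(x^ny^m)\qquad(n\in\mathbb Z,\ m\ge0).$$ For $\alpha\in(k^\times)^{\mathbb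 Z}$ and $i\ge1$ let $\alpha\langle i\rangle_n=\alpha_n\alpha_{n+1}\cdots\alpha_{n+i-1}$. The group $\mathbb Z$ acts on $(k^\times)^{\mathbb Z}$ by $(r\cdot\alpha)_n=\alpha_{n-r}$; let $(k^\times)^{\mathbb Z}\rtimes\mathbb Z$ be the corresponding semidirect product. **Theorem.** 1. There is a group structure on $G_\infty$ in which the product $(\delta^{(i)})_i=(\beta^{(i)})_i(\gamma^{(i)})_i$ is given recursively by $\delta^{(1)}=\beta^{(1)}+\gamma^{(1)}$ and, for $i>1$ and $n\in\mathbb Z$, $$\delta^{(i)}_n(x^{n+i}-x^n)=\phi^{(1)}_{\beta^{(1)}}\cdots\phi^{(i)}_{\beta^{(i)}}\,\phi^{(1)}_{\gamma^{(1)}}\cdots\phi^{(i)}_{\gamma^{(i)}}(x^ny^i)-\phi^{(1)}_{\delta^{(1)}}\cdots\phi^{(i-1)}_{\delta^{(i-1)}}(x^ny^i).$$ With this structure each $\Phi(g)$ is a coalgebra automorphism, and $g\mapsto\Phi(g)$ is an injective group homomorphism $G_\infty\to\mathrm{Aut}_c(H)$ with image $\mathrm{Aut}_*(H)$. 2. The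 formula $$(\alpha,r)\cdot(\beta^{(i)})_{i\ge1}=\Big(\big((\alpha^{-1})\langle i\rangle_n\,\beta^{(i)}_{n-r}\big)_{n\in\mathbb Z}\Big)_{i\ge1}$$ defines an action of $(k^\times)^{\mathbb Z}\rtimes\mathbb Z$ on $G_\infty$ by group automorphisms. Let $G_\infty\rtimes((k^\times)^{\mathbb Z}\rtimes\mathbb Z)$ be the resulting semidirect product, and $G_\infty\rtimes(k^\times)^{\mathbb Z}$ the one for the restriction of the action to $(k^\times)^{\mathbb Z}$. 3. There are group isomorphisms $$G_\infty\rtimes((k^\times)^{\mathbb Z}\rtimes\mathbb Z)\to\mathrm{Aut}_c(H),\quad(g,(\alpha,r))\mapsto\Phi(g)\,\phi_\alpha\,\theta_r,$$ $$G_\infty\rtimes(k^\times)^{\mathbb Z}\to\mathrm{Aut}_0(H),\quad(g,\alpha)\mapsto\Phi(g)\,\phi_\alpha.$$ -/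

import Mathlib

open scoped TensorProduct

namespace QuantumPlane

/-- The three generators `x`, `x⁻¹`, `y`. -/
inductive Gen : Type
  | x
  | xinv
  | y

/-- The defining relations `x x⁻¹ = 1`, `x⁻¹ x = 1`, `y x = q x y`. -/
inductive Rel {k : Type*} [Field k] (q : kˣ) : FreeAlgebra k Gen → FreeAlgebra k Gen → Prop
  | x_mul_xinv : Rel q (FreeAlgebra.ι k Gen.x * FreeAlgebra.ι k Gen.xinv) 1
  | xinv_mul_x : Rel q (FreeAlgebra.ι k Gen.xinv * FreeAlgebra.ι k Gen.x) 1
  | y_mul_x : Rel q (FreeAlgebra.ι k Gen.y * FreeAlgebra.ι k Gen.x)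
      ((q : k) • (FreeAlgebra.ι k Gen.x * FreeAlgebra.ι k Gen.y))

/-- The `k`-algebra `k_q[x, x⁻¹, y]` given by generators and relations. -/
def H {k : Type*} [Field k] (q : kˣ) : Type _ := RingQuot (Rel q)

noncomputable section

section Algebra

variable {k : Type*} [Field k] (q : kˣ)

instance : Ring (H q) := inferInstanceAs (Ring (RingQuot (Rel q)))

instance : Algebra k (H q) := inferInstanceAs (Algebra k (RingQuot (Rel q)))

/-- The quotient map from the free algebra. -/
def mk : FreeAlgebra k Gen →ₐ[k] H q := RingQuot.mkAlgHom k (Rel q)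

/-- The class of a generator. -/
def gen (g : Gen) : H q := mk q (FreeAlgebra.ι k g)

theorem gen_x_mul_xinv : gen q .x * gen q .xinv = 1 := by
  have := RingQuot.mkAlgHom_rel k (Rel.x_mul_xinv (q := q))
  rw [map_mul, map_one] at this
  exact this

theorem gen_xinv_mul_x : gen q .xinv * gen q .x = 1 := by
  have := RingQuot.mkAlgHom_rel k (Rel.xinv_mul_x (q := q))
  rw [map_mul, map_one] at this
  exact this

theorem gen_y_mul_x : gen q .y * gen q .x = (q : k) • (gen q .x * gen q .y) := by
  have := RingQuot.mkAlgHom_rel k (Rel.y_mul_x (q := q))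
  rw [map_mul, map_smul, map_mul] at this
  exact this

/-- The universal property of the presentation. -/
def lift {A : Type*} [Ring A] [Algebra k A] (f : Gen → A)
    (h₁ : f .x * f .xinv = 1) (h₂ : f .xinv * f .x = 1)
    (h₃ : f .y * f .x = (q : k) • (f .x * f .y)) : H q →ₐ[k] A :=
  RingQuot.liftAlgHom k ⟨FreeAlgebra.lift k f, by
    intro a b hab
    cases hab <;> simp [h₁, h₂, h₃]⟩

@[simp]
theorem lift_gen {A : Type*} [Ring A] [Algebra k A] (f : Gen → A)
    (h₁ : f .x * f .xinv = 1) (h₂ : f .xinv * f .x = 1)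
    (h₃ : f .y * f .x = (q : k) • (f .x * f .y)) (g : Gen) :
    lift q f h₁ h₂ h₃ (gen q g) = f g := by
  unfold lift gen mk
  erw [RingQuot.liftAlgHom_mkAlgHom_apply]
  simp

theorem algHom_ext' {A : Type*} [Ring A] [Algebra k A] {f g : H q →ₐ[k] A}
    (h : ∀ s, f (gen q s) = g (gen q s)) : f = g := by
  apply RingQuot.ringQuot_ext'
  apply FreeAlgebra.hom_ext
  funext s
  exact h s

end Algebra

section Coalgebra

variable {k : Type*} [Field k] (q : kˣ)

/-- `Δ(x) = x ⊗ x`, `Δ(x⁻¹) = x⁻¹ ⊗ x⁻¹`, `Δ(y) = y ⊗ x + 1 ⊗ y` on generators. -/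
def comulGen : Gen → H q ⊗[k] H q
  | .x => gen q .x ⊗ₜ gen q .x
  | .xinv => gen q .xinv ⊗ₜ gen q .xinv
  | .y => gen q .y ⊗ₜ gen q .x + 1 ⊗ₜ gen q .y

/-- `ε(x) = 1`, `ε(x⁻¹) = 1`, `ε(y) = 0` on generators. -/
def counitGen : Gen → k
  | .x => 1
  | .xinv => 1
  | .y => 0

/-- The comultiplication, as the algebra map determined by its values on the generators. -/
def comulHom : H q →ₐ[k] H q ⊗[k] H q :=
  lift q (comulGen q)
    (by simp [comulGen, gen_x_mul_xinv, Algebra.TensorProduct.one_def])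
    (by simp [comulGen, gen_xinv_mul_x, Algebra.TensorProduct.one_def])
    (by
      simp only [comulGen, add_mul, mul_add, Algebra.TensorProduct.tmul_mul_tmul, gen_y_mul_x,
        one_mul, mul_one, smul_add, TensorProduct.smul_tmul', TensorProduct.tmul_smul])

/-- The counit, as the algebra map determined by its values on the generators. -/
def counitHom : H q →ₐ[k] k :=
  lift q counitGen (by simp [counitGen]) (by simp [counitGen]) (by simp [counitGen])

instance : Bialgebra k (H q) :=
  Bialgebra.ofAlgHom (comulHom q) (counitHom q)
    (by
      apply algHom_ext'
      intro s
      cases s <;> simp [comulHom, comulGen, TensorProduct.tmul_add, TensorProduct.add_tmul,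
        Algebra.TensorProduct.one_def, add_assoc])
    (by
      apply algHom_ext'
      intro s
      cases s <;> simp [comulHom, counitHom, comulGen, counitGen])
    (by
      apply algHom_ext'
      intro s
      cases s <;> simp [comulHom, counitHom, comulGen, counitGen])

end Coalgebra

section Basis

variable {k : Type*} [Field k] (q : kˣ)

/-- The generator `x` as a unit of `k_q[x, x⁻¹, y]`. -/
def xUnit : (H q)ˣ := ⟨gen q .x, gen q .xinv, gen_x_mul_xinv q, gen_xinv_mul_x q⟩

/-- The monomial `xⁿ yᵐ`, for `n ∈ ℤ` and `m ∈ ℕ`. -/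
def mon (n : ℤ) (m : ℕ) : H q := ((xUnit q ^ n : (H q)ˣ) : H q) * gen q .y ^ m

/-- Operators of left multiplication by the generators in the (expected) basis of monomials. -/
def repGen : Gen → Module.End k ((ℤ × ℕ) →₀ k)
  | .x => Finsupp.lmapDomain k k (fun p => (p.1 + 1, p.2))
  | .xinv => Finsupp.lmapDomain k k (fun p => (p.1 - 1, p.2))
  | .y => Finsupp.lsum k (fun p => ((q ^ p.1 : kˣ) : k) • Finsupp.lsingle (p.1, p.2 + 1))

/-- The representation used for the linear independence of the monomials. -/
def rep : H q →ₐ[k] Module.End k ((ℤ × ℕ) →₀ k) :=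
  lift q (repGen q)
    (by ext p : 3; simp [repGen])
    (by ext p : 3; simp [repGen])
    (by
      ext p : 3
      simp [repGen, zpow_add_one₀ q.ne_zero, mul_comm])

theorem rep_x_zpow (n : ℤ) (j : ℤ) (m : ℕ) :
    rep q ((xUnit q ^ n : (H q)ˣ) : H q) (Finsupp.single (j, m) 1) =
      Finsupp.single (j + n, m) 1 := by
  induction n generalizing j with
  | zero => simp
  | succ i ih =>
    rw [zpow_add_one, Units.val_mul, map_mul, Module.End.mul_apply]
    have : rep q ((xUnit q : (H q)ˣ) : H q) (Finsupp.single (j, m) 1) =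
        Finsupp.single (j + 1, m) 1 := by simp [rep, xUnit, repGen]
    rw [this, ih]
    congr 2
    ring
  | pred i ih =>
    rw [zpow_sub_one, Units.val_mul, map_mul, Module.End.mul_apply]
    have : rep q (((xUnit q)⁻¹ : (H q)ˣ) : H q) (Finsupp.single (j, m) 1) =
        Finsupp.single (j - 1, m) 1 := by simp [rep, xUnit, repGen]
    rw [this, ih]
    congr 2
    ring

theorem rep_y_pow (m : ℕ) :
    rep q (gen q .y ^ m) (Finsupp.single ((0 : ℤ), 0) 1) = Finsupp.single ((0 : ℤ), m) 1 := by
  induction m with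
  | zero => simp
  | succ m ih =>
    rw [pow_succ', map_mul, Module.End.mul_apply, ih]
    simp [rep, repGen]

theorem rep_mon (n : ℤ) (m : ℕ) :
    rep q (mon q n m) (Finsupp.single ((0 : ℤ), 0) 1) = Finsupp.single (n, m) 1 := by
  rw [mon, map_mul, Module.End.mul_apply, rep_y_pow, rep_x_zpow, zero_add]

theorem linearIndependent_mon :
    LinearIndependent k (fun p : ℤ × ℕ => mon q p.1 p.2) := by
  let f : H q →ₗ[k] ((ℤ × ℕ) →₀ k) :=
    (LinearMap.applyₗ (Finsupp.single ((0 : ℤ), 0) 1)).comp (rep q).toLinearMap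
  apply LinearIndependent.of_comp f
  have : (f ∘ fun p : ℤ × ℕ => mon q p.1 p.2) = fun p => Finsupp.single p (1 : k) := by
    funext p
    exact rep_mon q p.1 p.2
  rw [this]
  exact Finsupp.linearIndependent_single_one k (ℤ × ℕ)

theorem y_mul_x_zpow (n : ℤ) :
    gen q .y * ((xUnit q ^ n : (H q)ˣ) : H q) =
      ((q ^ n : kˣ) : k) • (((xUnit q ^ n : (H q)ˣ) : H q) * gen q .y) := by
  have hx : gen q .y * ((xUnit q : (H q)ˣ) : H q) =
      (q : k) • (((xUnit q : (H q)ˣ) : H q) * gen q .y) := gen_y_mul_x q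
  have hxi : gen q .y * (((xUnit q)⁻¹ : (H q)ˣ) : H q) =
      ((q⁻¹ : kˣ) : k) • ((((xUnit q)⁻¹ : (H q)ˣ) : H q) * gen q .y) := by
    rw [Units.mul_inv_eq_iff_eq_mul, smul_mul_assoc, mul_assoc, hx, mul_smul_comm,
      Units.inv_mul_cancel_left, smul_smul]
    simp
  induction n with
  | zero => simp
  | succ i ih =>
    rw [zpow_add_one, Units.val_mul, ← mul_assoc, ih, smul_mul_assoc, mul_assoc, hx,
      mul_smul_comm, smul_smul, zpow_add_one, Units.val_mul, mul_assoc]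
  | pred i ih =>
    rw [zpow_sub_one, Units.val_mul, ← mul_assoc, ih, smul_mul_assoc, mul_assoc, hxi,
      mul_smul_comm, smul_smul, zpow_sub_one, Units.val_mul, mul_assoc]

theorem span_mon : ⊤ ≤ Submodule.span k (Set.range fun p : ℤ × ℕ => mon q p.1 p.2) := by
  set S := Submodule.span k (Set.range fun p : ℤ × ℕ => mon q p.1 p.2) with hS
  have hmem : ∀ n m, mon q n m ∈ S := fun n m => Submodule.subset_span ⟨(n, m), rfl⟩
  have hgen : ∀ s : Gen, ∀ h ∈ S, gen q s * h ∈ S := by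
    intro s h hh
    induction hh using Submodule.span_induction with
    | mem h hh =>
      obtain ⟨⟨n, m⟩, rfl⟩ := hh
      cases s with
      | x =>
        have : gen q .x * mon q n m = mon q (1 + n) m := by
          rw [mon, mon, zpow_add, zpow_one, Units.val_mul, mul_assoc]
          rfl
        simpa [this] using hmem (1 + n) m
      | xinv =>
        have : gen q .xinv * mon q n m = mon q (-1 + n) m := by
          rw [mon, mon, zpow_add, zpow_neg_one, Units.val_mul, mul_assoc]
          rfl
        simpa [this] using hmem (-1 + n) m
      | y =>
        have : gen q .y * mon q n m = ((q ^ n : kˣ) : k) • mon q n (m + 1) := by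
          rw [mon, mon, ← mul_assoc, y_mul_x_zpow, smul_mul_assoc, mul_assoc, pow_succ']
        simpa only [this] using S.smul_mem _ (hmem n (m + 1))
    | zero => simp
    | add a b _ _ ha hb => rw [mul_add]; exact S.add_mem ha hb
    | smul c a _ ha => rw [mul_smul_comm]; exact S.smul_mem c ha
  have hall : ∀ a : FreeAlgebra k Gen, ∀ h ∈ S, mk q a * h ∈ S := by
    intro a
    induction a using FreeAlgebra.induction with
    | grade0 r =>
      intro h hh
      rw [AlgHom.commutes, ← Algebra.smul_def]
      exact S.smul_mem r hh
    | grade1 s => exact hgen s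
    | mul a b ha hb =>
      intro h hh
      rw [map_mul, mul_assoc]
      exact ha _ (hb _ hh)
    | add a b ha hb =>
      intro h hh
      rw [map_add, add_mul]
      exact S.add_mem (ha _ hh) (hb _ hh)
  intro h _
  obtain ⟨a, rfl⟩ := RingQuot.mkAlgHom_surjective k (Rel q) h
  have h1 : (1 : H q) ∈ S := by simpa [mon] using hmem 0 0
  have := hall a 1 h1
  rwa [mul_one] at this

/-- The `k`-basis `{xⁿ yᵐ | n ∈ ℤ, m ∈ ℕ}`. -/
def monBasis : Module.Basis (ℤ × ℕ) k (H q) :=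
  Module.Basis.mk (linearIndependent_mon q) (span_mon q)

/-- The `k`-linear endomorphism with prescribed values `xⁿ yᵐ ↦ f n m`. -/
def ofMon (f : ℤ → ℕ → H q) : H q →ₗ[k] H q :=
  (monBasis q).constr k (fun p => f p.1 p.2)

theorem ofMon_mon (f : ℤ → ℕ → H q) (n : ℤ) (m : ℕ) : ofMon q f (mon q n m) = f n m := by
  have : mon q n m = monBasis q (n, m) := by simp [monBasis]
  rw [this, ofMon, Module.Basis.constr_basis]

end Basis

section Automorphisms

variable {k : Type*} [Field k] (q : kˣ)

/-- The coalgebra automorphisms of `k_q[x, x⁻¹, y]`. -/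
abbrev AutC : Type _ := H q ≃ₗc[k] H q

/-- They form a group under composition: `(φ * ψ) h = φ (ψ h)`. -/
instance : Group (AutC q) where
  mul φ ψ := ψ.trans φ
  one := CoalgEquiv.refl k (H q)
  inv φ := φ.symm
  mul_assoc _ _ _ := rfl
  one_mul _ := rfl
  mul_one _ := rfl
  inv_mul_cancel φ := CoalgEquiv.ext fun h => φ.symm_apply_apply h

/-- The subgroup of the coalgebra automorphisms that fix `1`. -/
def Aut0 : Subgroup (AutC q) where
  carrier := {φ | φ 1 = 1}
  one_mem' := rfl
  mul_mem' {φ ψ} hφ hψ := by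
    change φ (ψ 1) = 1
    rw [show ψ 1 = 1 from hψ]
    exact hφ
  inv_mem' {φ} hφ := by
    change φ.symm 1 = 1
    have h := φ.symm_apply_apply 1
    rwa [show φ 1 = 1 from hφ] at h

/-- The set of the coalgebra automorphisms `φ` fixing `1` for which there are scalars `βₙ` with
`φ(xⁿ y) = xⁿ y + βₙ (xⁿ⁺¹ - xⁿ)` for all `n`. -/
def AutStar : Set (AutC q) :=
  {φ | φ ∈ Aut0 q ∧ ∃ β : ℤ → k, ∀ n : ℤ,
    φ (mon q n 1) = mon q n 1 + β n • (mon q (n + 1) 0 - mon q n 0)}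

/-- `θ_r(xⁿ yᵐ) = xⁿ⁺ʳ yᵐ`. -/
def theta (r : ℤ) : H q →ₗ[k] H q := ofMon q fun n m => mon q (n + r) m

/-- `φ_α(xⁿ yᵐ) = αₙ αₙ₊₁ ⋯ αₙ₊ₘ₋₁ xⁿ yᵐ`. -/
def phiAlpha (α : ℤ → kˣ) : H q →ₗ[k] H q :=
  ofMon q fun n m => (∏ i ∈ Finset.range m, (α (n + i) : k)) • mon q n m

/-- The `q`-binomial coefficient, by the `q`-Pascal recursion
`binom(n, i) = qⁱ binom(n-1, i) + binom(n-1, i-1)` (it vanishes for `i > n`, so that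
`binom(n, n) = 1`). -/
def qBinom (a : k) : ℕ → ℕ → k
  | _, 0 => 1
  | 0, _ + 1 => 0
  | n + 1, i + 1 => a ^ (i + 1) * qBinom a n (i + 1) + qBinom a n i

/-- `binom(m, s)_{q,l} = ∏_{i < l} binom(m - i s, s)_q`, used for `l s ≤ m` only. -/
def qBinomProd (a : k) (m s l : ℕ) : k := ∏ i ∈ Finset.range l, qBinom a (m - i * s) s

/-- `β_{n,s;l} = βₙ βₙ₊ₛ ⋯ βₙ₊₍ₗ₋₁₎ₛ`. -/
def stepProd (β : ℤ → k) (n : ℤ) (s l : ℕ) : k := ∏ i ∈ Finset.range l, β (n + i * s)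

/-- The map `φ_β^{(s)}`, for `s ≥ 1`:
`xⁿ yᵐ ↦ xⁿ yᵐ + ∑_{1 ≤ i ≤ m/s} binom(m, s)_{q,i}
  (β_{n,s;i} xⁿ⁺ⁱˢ - β_{n,s;i-1} βₙ₊ₘ₋ₛ xⁿ⁺⁽ⁱ⁻¹⁾ˢ) yᵐ⁻ⁱˢ`;
the sum is written with `i + 1` in place of `i`. -/
def phiS (s : ℕ) (β : ℤ → k) : H q →ₗ[k] H q :=
  ofMon q fun n m => mon q n m +
    ∑ i ∈ Finset.range (m / s), qBinomProd (q : k) m s (i + 1) •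
      (stepProd β n s (i + 1) • mon q (n + (i + 1) * s) (m - (i + 1) * s)
        - (stepProd β n s i * β (n + m - s)) • mon q (n + i * s) (m - (i + 1) * s))

end Automorphisms

section GroupGInf

variable (k : Type*) [Field k]

/-- The set `G_∞` of the sequences `(β⁽¹⁾, β⁽²⁾, …)` with `β⁽ⁱ⁾ ∈ k^ℤ`. It is not an `abbrev`, so
that it does not inherit the pointwise operations. -/
def GInf : Type _ := ℕ+ → ℤ → k

variable {k}

/-- The composite `φ_{β⁽¹⁾}^{(1)} ∘ ⋯ ∘ φ_{β⁽ᵐ⁾}^{(m)}`. -/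
def phiComp (q : kˣ) (β : GInf k) : ℕ → (H q →ₗ[k] H q)
  | 0 => LinearMap.id
  | m + 1 => phiComp q β m ∘ₗ phiS q (m + 1) (β m.succPNat)

/-- The map `Φ(β)`: `xⁿ yᵐ ↦ φ_{β⁽¹⁾}^{(1)} ⋯ φ_{β⁽ᵐ⁾}^{(m)}(xⁿ yᵐ)`. -/
def bigPhi (q : kˣ) (β : GInf k) : H q →ₗ[k] H q :=
  ofMon q fun n m => phiComp q β m (mon q n m)

/-- `δ` is the product of `β` and `γ` in `G_∞`: it satisfies the recursion
`δ⁽¹⁾ = β⁽¹⁾ + γ⁽¹⁾` and, for `i > 1`,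
`δₙ⁽ⁱ⁾ (xⁿ⁺ⁱ - xⁿ) = φ_{β⁽¹⁾}^{(1)} ⋯ φ_{β⁽ⁱ⁾}^{(i)} φ_{γ⁽¹⁾}^{(1)} ⋯ φ_{γ⁽ⁱ⁾}^{(i)}(xⁿ yⁱ)
  - φ_{δ⁽¹⁾}^{(1)} ⋯ φ_{δ⁽ⁱ⁻¹⁾}^{(i-1)}(xⁿ yⁱ)`.
Since `xⁿ⁺ⁱ ≠ xⁿ`, there is at most one such `δ`. -/
def IsProduct (q : kˣ) (β γ δ : GInf k) : Prop :=
  (∀ n : ℤ, δ 1 n = β 1 n + γ 1 n) ∧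
  ∀ i : ℕ+, 1 < i → ∀ n : ℤ,
    δ i n • (mon q (n + (i : ℕ)) 0 - mon q n 0) =
      phiComp q β i (phiComp q γ i (mon q n i)) - phiComp q δ ((i : ℕ) - 1) (mon q n i)

/-- `r · α = α[-r]`, that is `(r · α)ₙ = αₙ₋ᵣ`, as an action of `ℤ` on `(k^×)^ℤ` by group
automorphisms. -/
def shiftAction : Multiplicative ℤ →* MulAut (ℤ → kˣ) where
  toFun r :=
    { toFun := fun α n => α (n - r.toAdd)
      invFun := fun α n => α (n + r.toAdd)
      left_inv := fun α => by funext n; simp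
      right_inv := fun α => by funext n; simp
      map_mul' := fun _ _ => rfl }
  map_one' := by
    ext α n
    simp
  map_mul' r t := by
    ext α n
    simp [sub_sub]

/-- `(α, r) · (β⁽ⁱ⁾)ᵢ = (α⁻¹⟨i⟩ β⁽ⁱ⁾[-r])ᵢ`, where `α⟨i⟩ = α α[1] ⋯ α[i-1]`. -/
def actFun (α : ℤ → kˣ) (r : ℤ) (β : GInf k) : GInf k :=
  fun i n => (∏ j ∈ Finset.range i, (((α (n + j))⁻¹ : kˣ) : k)) * β i (n - r)

end GroupGInf

end

end QuantumPlane

/-!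
The comultiplication is `Δ(xⁿ yᵐ) = ∑ᵢ binom(m, i)_q xⁿ yⁱ ⊗ xⁿ⁺ⁱ yᵐ⁻ⁱ`. As `q` is not a root of
unity, the `q`-factorials are invertible, and the divided powers `E a b = xᵃ yᵇ⁻ᵃ / [b - a]!`
satisfy `Δ(E a b) = ∑ E a c ⊗ E c b`, the sum over `a ≤ c ≤ b` (`comul_E`): `H` is the incidence
coalgebra of the ordered set `ℤ`. Two consequences of this formula, read off by comparing
coefficients, carry the classification: the group-like elements are the powers of `x`
(`eq_mon_of_isGroupLikeElem`), and for `a < b` the skew-primitive elements for `(xᵃ, xᵇ)` are the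
multiples of `xᵇ - xᵃ`, or, when `b = a + 1`, the combinations of `xᵇ - xᵃ` and `E a b`
(`skewPrimitive`, `skewPrimitive_of_lt`).

The incidence algebra of `ℤ` acts on `H` from both ends of the intervals. The map `phiS s β` is `L⁻¹
R`, where `L` and `R` are the two actions of the element `1 - N` with `N` equal to `βₐ / [s]!` at
`[a, a + s]` (`leftEndOp_comp_phiS`), that is, an inner automorphism; hence it is a morphism of
coalgebras (`comul_phiS`). It is the identity in degrees `< s`, so that `bigPhi β`, which agrees
with a finite composite of the `phiS` in each degree, is a morphism of coalgebras as well; it is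
bijective since it is unipotent for the degree filtration.

Conversely, let `φ` be in `AutStar`. If `φ` and `bigPhi β` agree in degrees `< m`, their difference
on `xⁿ yᵐ` is skew-primitive, hence a multiple of `xⁿ⁺ᵐ - xⁿ` (for `m = 1`, by the definition of
`AutStar`), and there is exactly one choice of `β⁽ᵐ⁾` that makes them agree in degree `m`. So
`bigPhi` is a bijection from `GInf` to the group `AutStar` (`bigPhiAut_injective`,
`exists_bigPhiAut_eq`); the group structure is transported along it, and the recursion is the value
of `bigPhi δ = bigPhi β ∘ bigPhi γ` on `xⁿ yⁱ`.

The formula for the action is conjugation by `phiAlpha α ∘ theta r` (`monomialHom_bigPhi`). Finally,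
an arbitrary coalgebra automorphism permutes the powers of `x`, and it maps `xⁿ y` to a
skew-primitive element with a nonzero component in degree one, so that the permutation of `ℤ` is
increasing, hence a shift (`exists_shift`); dividing by a shift and by a diagonal map leads to
`AutStar` (`exists_mul_inv_mem_autStar`).
-/

namespace QuantumPlane

noncomputable section

open Coalgebra

variable {k : Type*} [Field k]

/-! ### `q`-factorials and the comultiplication of monomials -/

section

/-- The `q`-integer `[n] = 1 + a + ⋯ + aⁿ⁻¹`. -/
def qInt (a : k) (n : ℕ) : k := ∑ i ∈ Finset.range n, a ^ i

/-- The `q`-factorial `[n]! = [1] [2] ⋯ [n]`. -/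
def qFac (a : k) (n : ℕ) : k := ∏ i ∈ Finset.range n, qInt a (i + 1)

theorem qFac_zero (a : k) : qFac a 0 = 1 := by simp [qFac]

theorem qFac_one (a : k) : qFac a 1 = 1 := by simp [qFac, qInt]

theorem qFac_succ (a : k) (n : ℕ) : qFac a (n + 1) = qFac a n * qInt a (n + 1) :=
  Finset.prod_range_succ _ _

theorem qInt_add (a : k) (i j : ℕ) : qInt a (i + j) = qInt a i + a ^ i * qInt a j := by
  simp only [qInt, Finset.sum_range_add, Finset.mul_sum, pow_add]

theorem qFac_ne_zero {a : k} (ha : ∀ n : ℕ, 0 < n → a ^ n ≠ 1) (n : ℕ) : qFac a n ≠ 0 := by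
  refine Finset.prod_ne_zero_iff.2 fun i _ h => ha (i + 1) i.succ_pos ?_
  have := geom_sum_mul a (i + 1)
  rw [show ∑ j ∈ Finset.range (i + 1), a ^ j = 0 from h, zero_mul] at this
  exact (sub_eq_zero.1 this.symm)

theorem qBinom_zero_right (a : k) (n : ℕ) : qBinom a n 0 = 1 := by cases n <;> rfl

theorem qBinom_succ_succ (a : k) (n i : ℕ) :
    qBinom a (n + 1) (i + 1) = a ^ (i + 1) * qBinom a n (i + 1) + qBinom a n i := rfl

theorem qBinom_eq_zero (a : k) {n i : ℕ} (h : n < i) : qBinom a n i = 0 := by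
  induction n generalizing i with
  | zero => cases i with
    | zero => omega
    | succ i => rfl
  | succ n ih => cases i with
    | zero => omega
    | succ i => rw [qBinom_succ_succ, ih (by omega), ih (by omega), mul_zero, add_zero]

theorem qBinom_mul_qFac (a : k) (i j : ℕ) :
    qBinom a (i + j) i * (qFac a i * qFac a j) = qFac a (i + j) := by
  induction h : i + j generalizing i j with
  | zero =>
    obtain ⟨rfl, rfl⟩ : i = 0 ∧ j = 0 := by omega
    simp [qFac_zero, qBinom_zero_right]
  | succ n ih =>
    obtain _ | i := i
    · simp only [zero_add] at h
      simp [qFac_zero, qBinom_zero_right, h]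
    have h1 := ih i j (by omega)
    obtain _ | j := j
    · obtain rfl : n = i := by omega
      rw [qBinom_succ_succ, qBinom_eq_zero a n.lt_succ_self, qFac_succ]
      linear_combination qInt a (n + 1) * h1
    · have h2 := ih (i + 1) j (by omega)
      have h3 : qInt a (n + 1) = qInt a (i + 1) + a ^ (i + 1) * qInt a (j + 1) := by
        rw [← qInt_add]; congr 1; omega
      rw [qBinom_succ_succ, qFac_succ a n, h3, qFac_succ a i, qFac_succ a j, mul_add]
      nth_rewrite 1 [← h1]
      rw [← h2, qFac_succ a i, qFac_succ a j]
      ring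

theorem qBinomProd_mul_qFac (a : k) {m s l : ℕ} (h : l * s ≤ m) :
    qBinomProd a m s l * (qFac a s ^ l * qFac a (m - l * s)) = qFac a m := by
  induction l with
  | zero => simp [qBinomProd]
  | succ l ih =>
    rw [add_mul, one_mul] at h
    rw [← ih (by omega), qBinomProd, Finset.prod_range_succ]
    have := qBinom_mul_qFac a s (m - (l * s + s))
    rw [show s + (m - (l * s + s)) = m - l * s by omega] at this
    rw [← this, add_mul, one_mul, qBinomProd]
    ring

variable (q : kˣ)

theorem mon_zero_right (n : ℤ) : mon q n 0 = ((xUnit q ^ n : (H q)ˣ) : H q) := by simp [mon]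

theorem mon_zero_zero : mon q 0 0 = 1 := by simp [mon]

theorem mon_eq_mul (n : ℤ) (m : ℕ) : mon q n m = mon q n 0 * mon q 0 m := by
  simp [mon]

theorem monBasis_apply (p : ℤ × ℕ) : monBasis q p = mon q p.1 p.2 := by simp [monBasis]

theorem mon_add (a b : ℤ) : mon q (a + b) 0 = mon q a 0 * mon q b 0 := by
  simp [mon_zero_right, zpow_add]

theorem comul_mon_zero (n : ℤ) : comul (R := k) (mon q n 0) = mon q n 0 ⊗ₜ mon q n 0 := by
  have hc : ∀ h : H q, comul (R := k) h = comulHom q h := fun _ => rfl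
  have hx : comulHom q (mon q 1 0) = mon q 1 0 ⊗ₜ mon q 1 0 := by
    simp [mon, xUnit, comulHom, comulGen]
  have hxi : comulHom q (mon q (-1) 0) = mon q (-1) 0 ⊗ₜ mon q (-1) 0 := by
    simp [mon, xUnit, comulHom, comulGen]
  rw [hc]
  induction n with
  | zero => simp [mon_zero_zero, Algebra.TensorProduct.one_def]
  | succ i ih => rw [mon_add, map_mul, ih, hx, Algebra.TensorProduct.tmul_mul_tmul]
  | pred i ih => rw [sub_eq_add_neg, mon_add, map_mul, ih, hxi, Algebra.TensorProduct.tmul_mul_tmul]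

theorem mon_zero_succ (m : ℕ) : mon q 0 (m + 1) = gen q .y * mon q 0 m := by
  simp [mon, pow_succ']

theorem gen_y_mul_mon (n : ℤ) (m : ℕ) :
    gen q .y * mon q n m = ((q ^ n : kˣ) : k) • mon q n (m + 1) := by
  rw [mon, mon, ← mul_assoc, y_mul_x_zpow, smul_mul_assoc, mul_assoc, pow_succ']

theorem gen_x_mul_mon (n : ℤ) (m : ℕ) : gen q .x * mon q n m = mon q (n + 1) m := by
  rw [mon, mon, add_comm, zpow_add, zpow_one, Units.val_mul, mul_assoc]
  rfl

theorem comul_mon (n : ℤ) (m : ℕ) :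
    comul (R := k) (mon q n m) =
      ∑ i ∈ Finset.range (m + 1), qBinom (q : k) m i • (mon q n i ⊗ₜ[k] mon q (n + i) (m - i)) := by
  have hc : ∀ h : H q, comul (R := k) h = comulHom q h := fun _ => rfl
  have key : comulHom q (mon q 0 m) =
      ∑ i ∈ Finset.range (m + 1), qBinom (q : k) m i • (mon q 0 i ⊗ₜ[k] mon q i (m - i)) := by
    induction m with
    | zero => simp [qBinom_zero_right, mon_zero_zero, Algebra.TensorProduct.one_def]
    | succ m ih =>
      have hy : comulHom q (gen q .y) = gen q .y ⊗ₜ gen q .x + 1 ⊗ₜ gen q .y := by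
        simp [comulHom, comulGen]
      rw [mon_zero_succ, map_mul, ih, hy, add_mul, Finset.mul_sum, Finset.mul_sum]
      simp only [mul_smul_comm, Algebra.TensorProduct.tmul_mul_tmul, gen_y_mul_mon, gen_x_mul_mon,
        one_mul, zpow_zero, Units.val_one, one_smul]
      rw [Finset.sum_range_succ' _ (m + 1)]
      simp only [qBinom_succ_succ, add_smul, Finset.sum_add_distrib, qBinom_zero_right]
      conv_rhs => rw [add_assoc, add_left_comm]
      congr 1
      · refine Finset.sum_congr rfl fun i _ => ?_
        rw [Nat.cast_succ, Nat.add_sub_add_right]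
      · rw [Finset.sum_range_succ', Finset.sum_range_succ _ m, qBinom_eq_zero _ m.lt_succ_self]
        simp only [mul_zero, zero_smul, add_zero, qBinom_zero_right]
        congr 1
        · refine Finset.sum_congr rfl fun i hi => ?_
          rw [TensorProduct.tmul_smul, smul_smul, mul_comm, zpow_natCast, Units.val_pow_eq_pow_val,
            Nat.add_sub_add_right]
          rw [show m - (i + 1) + 1 = m - i by have := Finset.mem_range.1 hi; omega]
        · simp
  have h0 := comul_mon_zero q n
  rw [hc] at h0
  rw [hc, mon_eq_mul, map_mul, key, h0, Finset.mul_sum]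
  refine Finset.sum_congr rfl fun i _ => ?_
  rw [mul_smul_comm, Algebra.TensorProduct.tmul_mul_tmul, ← mon_eq_mul, mon_eq_mul q (i : ℤ),
    ← mul_assoc, ← mon_add, ← mon_eq_mul]

theorem counit_mon (n : ℤ) (m : ℕ) :
    counit (R := k) (mon q n m) = if m = 0 then 1 else 0 := by
  have hc : ∀ h : H q, counit (R := k) h = counitHom q h := fun _ => rfl
  have hy : counitHom q (gen q .y) = 0 := by simp [counitHom, counitGen]
  have hx : counitHom q (mon q 1 0) = 1 := by simp [mon, xUnit, counitHom, counitGen]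
  have hxi : counitHom q (mon q (-1) 0) = 1 := by simp [mon, xUnit, counitHom, counitGen]
  have h0 : counitHom q (mon q n 0) = 1 := by
    induction n with
    | zero => simp [mon_zero_zero]
    | succ i ih => rw [mon_add, map_mul, ih, hx, one_mul]
    | pred i ih => rw [sub_eq_add_neg, mon_add, map_mul, ih, hxi, one_mul]
  rw [hc, mon_eq_mul, map_mul, h0, one_mul]
  cases m with
  | zero => simp [mon_zero_zero]
  | succ m => rw [mon_zero_succ, map_mul, hy]; simp

/-- Linear maps out of `H` are determined by their values on the monomials. -/
theorem ext_mon {M : Type*} [AddCommMonoid M] [Module k M] {f g : H q →ₗ[k] M}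
    (h : ∀ n m, f (mon q n m) = g (mon q n m)) : f = g :=
  (monBasis q).ext fun p => by rw [monBasis_apply]; exact h _ _

/-! ### The coalgebra `H` as the incidence coalgebra of `ℤ` -/

/-- The basis element of the incidence coalgebra of `(ℤ, ≤)` attached to the interval `[a, b]`:
the divided power `xᵃ yᵇ⁻ᵃ / [b - a]!`, with the value `0` when `b < a`. -/
def E (a b : ℤ) : H q :=
  if a ≤ b then (qFac (q : k) (b - a).toNat)⁻¹ • mon q a (b - a).toNat else 0

theorem E_eq_zero {a b : ℤ} (h : b < a) : E q a b = 0 := if_neg (not_le.2 h)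

theorem E_add (a : ℤ) (m : ℕ) : E q a (a + m) = (qFac (q : k) m)⁻¹ • mon q a m := by
  rw [E, if_pos (by omega), show (a + m - a).toNat = m by omega]

theorem E_self (a : ℤ) : E q a a = mon q a 0 := by
  simpa [qFac_zero] using E_add q a 0

theorem E_succ (a : ℤ) : E q a (a + 1) = mon q a 1 := by
  simpa [qFac_one] using E_add q a 1

theorem counit_E (a b : ℤ) : counit (R := k) (E q a b) = if a = b then 1 else 0 := by
  by_cases h : a ≤ b
  · obtain ⟨m, rfl⟩ := Int.le.dest h
    rw [E_add, map_smul, counit_mon]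
    rcases m with _ | m
    · simp [qFac_zero]
    · rw [if_neg (by omega), if_neg (by omega), smul_zero]
  · rw [E_eq_zero q (not_le.1 h), map_zero, if_neg (by omega)]

variable {q} (hq : ∀ n : ℕ, 0 < n → (q : k) ^ n ≠ 1)
include hq

theorem mon_eq_E (a : ℤ) (m : ℕ) : mon q a m = qFac (q : k) m • E q a (a + m) := by
  rw [E_add, smul_inv_smul₀ (qFac_ne_zero hq m)]

/-- The comultiplication of the incidence coalgebra: an interval is cut in all possible ways. -/
theorem comul_E (a b : ℤ) :
    comul (R := k) (E q a b) = ∑ c ∈ Finset.Icc a b, E q a c ⊗ₜ[k] E q c b := by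
  by_cases h : a ≤ b
  · obtain ⟨m, rfl⟩ := Int.le.dest h
    rw [E_add, map_smul, comul_mon, Finset.smul_sum]
    refine Finset.sum_nbij' (fun i : ℕ => a + i) (fun c => (c - a).toNat) ?_ ?_ ?_ ?_ ?_
    · intro i hi; simp only [Finset.mem_range, Finset.mem_Icc] at *; omega
    · intro c hc; simp only [Finset.mem_range, Finset.mem_Icc] at *; omega
    · intro i hi; simp
    · intro c hc; simp only [Finset.mem_Icc] at *; omega
    · intro i hi
      have hi' : i ≤ m := by simpa [Nat.lt_succ_iff] using hi
      obtain ⟨j, rfl⟩ := Nat.exists_eq_add_of_le hi'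
      rw [Nat.add_sub_cancel_left, Nat.cast_add, ← add_assoc, E_add, E_add,
        TensorProduct.smul_tmul_smul, smul_smul, ← qBinom_mul_qFac]
      congr 1
      have h1 := qFac_ne_zero hq i
      have h2 := qFac_ne_zero hq j
      have h3 : qBinom (q : k) (i + j) i ≠ 0 := by
        intro h0
        have := qBinom_mul_qFac (q : k) i j
        rw [h0, zero_mul] at this
        exact qFac_ne_zero hq _ this.symm
      field_simp
  · rw [E_eq_zero q (not_le.1 h), map_zero, Finset.Icc_eq_empty h, Finset.sum_empty]

theorem ext_E {M : Type*} [AddCommMonoid M] [Module k M] {f g : H q →ₗ[k] M}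
    (h : ∀ a b, a ≤ b → f (E q a b) = g (E q a b)) : f = g :=
  ext_mon q fun n m => by rw [mon_eq_E hq, map_smul, map_smul, h _ _ (by omega)]

omit hq in
variable (q) in
/-- The coefficient of `E c d`, as a linear functional; it is `0` when `d < c`. -/
def coef (c d : ℤ) : H q →ₗ[k] k :=
  if c ≤ d then qFac (q : k) (d - c).toNat • (monBasis q).coord (c, (d - c).toNat) else 0

theorem coef_E (c d a b : ℤ) :
    coef q c d (E q a b) = if a = c ∧ b = d ∧ a ≤ b then 1 else 0 := by
  by_cases h : a ≤ b
  · obtain ⟨m, rfl⟩ := Int.le.dest h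
    unfold coef
    split_ifs with h1 h2 h2
    · obtain ⟨rfl, rfl, -⟩ := h2
      rw [E_add, show (a + m - a).toNat = m by omega, ← monBasis_apply q (a, m)]
      simp [qFac_ne_zero hq]
    · rw [E_add, ← monBasis_apply q (a, m)]
      simp only [LinearMap.smul_apply, map_smul, Module.Basis.coord_apply,
        Module.Basis.repr_self]
      rw [Finsupp.single_eq_of_ne (by rintro ⟨⟩; omega)]
      simp
    · omega
    · simp
  · rw [E_eq_zero q (not_le.1 h), map_zero, if_neg (by omega)]

theorem ext_coef {g h : H q} (H : ∀ c d, c ≤ d → coef q c d g = coef q c d h) : g = h := by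
  refine (monBasis q).ext_elem fun p => ?_
  have := H p.1 (p.1 + p.2) (by omega)
  rw [coef, if_pos (by omega)] at this
  simpa [qFac_ne_zero hq] using this

omit hq in
variable (q) in
/-- The functional on `H ⊗ H` given by a pair of coefficients. -/
def coef₂ (c e e' d : ℤ) : H q ⊗[k] H q →ₗ[k] k :=
  LinearMap.mul' k k ∘ₗ TensorProduct.map (coef q c e) (coef q e' d)

omit hq in
theorem coef₂_tmul (c e e' d : ℤ) (g h : H q) :
    coef₂ q c e e' d (g ⊗ₜ h) = coef q c e g * coef q e' d h := rfl

theorem coef₂_comul {c e d : ℤ} (h₁ : c ≤ e) (h₂ : e ≤ d) (h : H q) :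
    coef₂ q c e e d (comul h) = coef q c d h := by
  suffices coef₂ q c e e d ∘ₗ comul = coef q c d from LinearMap.congr_fun this h
  refine ext_E hq fun a b hab => ?_
  rw [LinearMap.comp_apply, comul_E hq, map_sum, coef_E hq]
  simp only [coef₂_tmul, coef_E hq]
  rw [Finset.sum_eq_single e]
  · split_ifs <;> first | rfl | omega | simp
  · intro x _ hx
    rw [if_neg (by tauto), zero_mul]
  · intro he
    rw [Finset.mem_Icc] at he
    split_ifs <;> first | omega | simp

theorem coef₂_comul_of_ne {e e' : ℤ} (hne : e ≠ e') (c d : ℤ) (h : H q) :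
    coef₂ q c e e' d (comul h) = 0 := by
  suffices coef₂ q c e e' d ∘ₗ comul = 0 from LinearMap.congr_fun this h
  refine ext_E hq fun a b hab => ?_
  rw [LinearMap.comp_apply, comul_E hq, map_sum]
  simp only [coef₂_tmul, coef_E hq]
  refine Finset.sum_eq_zero fun x _ => ?_
  split_ifs <;> first | omega | simp

end

/-! ### Group-like and skew-primitive elements -/

section

variable (q : kˣ)

theorem mon_zero_injective : Function.Injective fun n : ℤ => mon q n 0 := fun a b h => by
  have := (linearIndependent_mon q).injective (a₁ := (a, 0)) (a₂ := (b, 0)) h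
  exact congrArg Prod.fst this

theorem isGroupLikeElem_mon (n : ℤ) : IsGroupLikeElem k (mon q n 0) where
  counit_eq_one := by simp [counit_mon]
  comul_eq_tmul_self := comul_mon_zero q n

variable {q} (hq : ∀ n : ℕ, 0 < n → (q : k) ^ n ≠ 1)
include hq

theorem coef_mon_zero (c d n : ℤ) :
    coef q c d (mon q n 0) = if n = c ∧ n = d then 1 else 0 := by
  simp [← E_self, coef_E hq]

/-- The group-like elements of `H` are the powers of `x`: for a group-like `g`, the coefficients
satisfy `g_{ce} g_{e'd} = g_{cd}` if `e = e'` and `0` otherwise, so that exactly one of the `g_{nn}`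
is nonzero, and all `g_{cd} = g_{cc} g_{cd} = g_{cd} g_{dd}` with `(c, d) ≠ (n, n)` vanish. -/
theorem eq_mon_of_isGroupLikeElem {g : H q} (hg : IsGroupLikeElem k g) :
    ∃ n, g = mon q n 0 := by
  have h1 : ∀ c e d, c ≤ e → e ≤ d → coef q c e g * coef q e d g = coef q c d g := by
    intro c e d hce hed
    rw [← coef₂_comul hq hce hed g, hg.comul_eq_tmul_self, coef₂_tmul]
  have h2 : ∀ c e e' d, e ≠ e' → coef q c e g * coef q e' d g = 0 := by
    intro c e e' d he
    rw [← coef₂_comul_of_ne hq he c d g, hg.comul_eq_tmul_self, coef₂_tmul]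
  obtain ⟨n, hn⟩ : ∃ n, coef q n n g ≠ 0 := by
    by_contra! h
    refine hg.ne_zero (ext_coef hq fun c d hcd => ?_)
    rw [← h1 c c d le_rfl hcd, h c, zero_mul, map_zero]
  refine ⟨n, ext_coef hq fun c d hcd => ?_⟩
  have hne : ∀ c, c ≠ n → coef q c c g = 0 := fun c hc =>
    (mul_eq_zero.1 (h2 c c n n hc)).resolve_right hn
  rw [coef_mon_zero hq]
  split_ifs with h
  · obtain ⟨rfl, rfl⟩ := h
    exact mul_right_cancel₀ hn ((h1 n n n le_rfl le_rfl).trans (one_mul _).symm)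
  · by_cases hc : c = n
    · rw [← h1 c d d hcd le_rfl, hne d (by omega), mul_zero]
    · rw [← h1 c c d le_rfl hcd, hne c hc, zero_mul]

/-- A skew-primitive element for the pair `(xᵃ, xᵇ)` is a combination of `E a b` and `xᵇ - xᵃ`. -/
theorem skewPrimitive {a b : ℤ} (hab : a ≠ b) {z : H q}
    (hz : comul (R := k) z = mon q a 0 ⊗ₜ z + z ⊗ₜ mon q b 0) :
    z = coef q a b z • E q a b + coef q b b z • (mon q b 0 - mon q a 0) := by
  have h1 : ∀ c e d, c ≤ e → e ≤ d → coef q c d z =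
      (if a = c ∧ a = e then 1 else 0) * coef q e d z +
        coef q c e z * (if b = e ∧ b = d then 1 else 0) := by
    intro c e d hce hed
    rw [← coef_mon_zero hq, ← coef_mon_zero hq, ← coef₂_comul hq hce hed z, hz, map_add,
      coef₂_tmul, coef₂_tmul]
  have h2 : coef q b b z + coef q a a z = 0 := by
    have := coef₂_comul_of_ne hq hab a b z
    rw [hz, map_add, coef₂_tmul, coef₂_tmul, coef_mon_zero hq, coef_mon_zero hq] at this
    simpa using this
  refine ext_coef hq fun c d hcd => ?_
  simp only [map_add, map_smul, map_sub, coef_E hq, coef_mon_zero hq, smul_eq_mul]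
  by_cases hd : c = d
  · subst hd
    rw [if_neg (by omega)]
    by_cases hca : c = a
    · subst hca
      rw [if_neg (by omega), if_pos ⟨rfl, rfl⟩]
      linear_combination h2
    · by_cases hcb : c = b
      · subst hcb
        rw [if_pos ⟨rfl, rfl⟩, if_neg (by omega)]
        ring
      · have := h1 c c c le_rfl le_rfl
        rw [if_neg (by omega), if_neg (by omega)] at this
        rw [if_neg (by omega), if_neg (by omega), this]
        ring
  · rw [if_neg (c := b = c ∧ b = d) (by omega), if_neg (c := a = c ∧ a = d) (by omega)]
    by_cases hc : a = c ∧ b = d ∧ a ≤ b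
    · obtain ⟨rfl, rfl, h⟩ := hc
      simp [h]
    · rw [if_neg hc]
      have h3 := h1 c c d le_rfl hcd
      have h4 := h1 c d d hcd le_rfl
      rw [if_neg (c := b = c ∧ b = d) (by omega)] at h3
      rw [if_neg (c := a = c ∧ a = d) (by omega)] at h4
      by_cases hac : a = c
      · rw [if_neg (by omega)] at h4
        rw [h4]; ring
      · rw [if_neg (by omega)] at h3
        rw [h3]; ring

/-- The component at `E a b` vanishes if the interval `[a, b]` can be cut in its interior. -/
theorem skewPrimitive_of_lt {a b : ℤ} (hab : a + 1 < b) {z : H q}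
    (hz : comul (R := k) z = mon q a 0 ⊗ₜ z + z ⊗ₜ mon q b 0) :
    z = coef q b b z • (mon q b 0 - mon q a 0) := by
  have h : coef q a b z = 0 := by
    rw [← coef₂_comul hq (e := a + 1) (by omega) (by omega) z, hz, map_add, coef₂_tmul, coef₂_tmul,
      coef_mon_zero hq, coef_mon_zero hq, if_neg (by omega), if_neg (by omega)]
    ring
  have := skewPrimitive hq (by omega) hz
  rwa [h, zero_smul, zero_add] at this

theorem comul_mon_one (n : ℤ) :
    comul (R := k) (mon q n 1) = mon q n 0 ⊗ₜ mon q n 1 + mon q n 1 ⊗ₜ mon q (n + 1) 0 := by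
  rw [← E_succ, comul_E hq, Finset.sum_eq_add n (n + 1) (by omega)]
  · simp [E_self]
  · intro c hc h
    rw [Finset.mem_Icc] at hc
    omega
  · intro h
    exact absurd (Finset.mem_Icc.2 ⟨le_rfl, by omega⟩) h
  · intro h
    exact absurd (Finset.mem_Icc.2 ⟨by omega, le_rfl⟩) h

theorem comul_apply_mon_one (φ : H q →ₗc[k] H q) (n : ℤ) :
    comul (R := k) (φ (mon q n 1)) =
      φ (mon q n 0) ⊗ₜ φ (mon q n 1) + φ (mon q n 1) ⊗ₜ φ (mon q (n + 1) 0) := by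
  rw [← CoalgHomClass.map_comp_comul_apply, comul_mon_one hq]
  simp

/-- If two coalgebra endomorphisms agree on the monomials of degree `< m`, where `m ≥ 2`, and fix
the group-like elements, then their difference on `xⁿ yᵐ` is skew-primitive, hence a multiple of
`xⁿ⁺ᵐ - xⁿ`. -/
theorem sub_eq_of_agree {φ ψ : H q →ₗc[k] H q} {m : ℕ} (hm : 1 < m)
    (hfix : ∀ n, φ (mon q n 0) = mon q n 0)
    (h : ∀ n j, j < m → φ (mon q n j) = ψ (mon q n j)) (n : ℤ) :
    φ (mon q n m) - ψ (mon q n m) =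
      coef q (n + m) (n + m) (φ (mon q n m) - ψ (mon q n m)) •
        (mon q (n + m) 0 - mon q n 0) := by
  have hE : ∀ a b : ℤ, b - a < m → φ (E q a b) = ψ (E q a b) := by
    intro a b hb
    by_cases hab : a ≤ b
    · obtain ⟨j, rfl⟩ := Int.le.dest hab
      rw [E_add, map_smul, map_smul, h _ _ (by omega)]
    · rw [E_eq_zero q (not_le.1 hab), map_zero, map_zero]
  set z := φ (E q n (n + m)) - ψ (E q n (n + m)) with hz
  have hsk : comul (R := k) z = mon q n 0 ⊗ₜ z + z ⊗ₜ mon q (n + m) 0 := by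
    rw [hz, map_sub, ← CoalgHomClass.map_comp_comul_apply, ← CoalgHomClass.map_comp_comul_apply,
      comul_E hq, map_sum, map_sum, ← Finset.sum_sub_distrib,
      Finset.sum_eq_add n (n + m) (by omega)]
    · have e1 : φ (E q n n) = mon q n 0 := by rw [E_self, hfix]
      have e2 : φ (E q (n + m) (n + m)) = mon q (n + m) 0 := by rw [E_self, hfix]
      simp only [TensorProduct.map_tmul, CoalgHom.coe_toLinearMap, ← hE n n (by omega),
        ← hE (n + m) (n + m) (by omega), e1, e2, TensorProduct.tmul_sub, TensorProduct.sub_tmul]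
    · intro c hc hne
      rw [Finset.mem_Icc] at hc
      simp only [TensorProduct.map_tmul, CoalgHom.coe_toLinearMap, hE n c (by omega),
        hE c (n + m) (by omega), sub_self]
    · intro hn
      exact absurd (Finset.mem_Icc.2 ⟨le_rfl, by omega⟩) hn
    · intro hn
      exact absurd (Finset.mem_Icc.2 ⟨by omega, le_rfl⟩) hn
  have hmon : φ (mon q n m) - ψ (mon q n m) = qFac (q : k) m • z := by
    rw [mon_eq_E hq, map_smul, map_smul, ← smul_sub]
  rw [hmon, map_smul, smul_assoc, ← skewPrimitive_of_lt hq (by omega) hsk]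

end

/-! ### The degree filtration -/

section

variable (q : kˣ)

/-- The span of the monomials `xⁿ yʲ` with `j < m`. -/
def degLT (m : ℕ) : Submodule k (H q) := Submodule.span k {h | ∃ n j, j < m ∧ mon q n j = h}

variable {q}

theorem mon_mem_degLT {m j : ℕ} (h : j < m) (n : ℤ) : mon q n j ∈ degLT q m :=
  Submodule.subset_span ⟨n, j, h, rfl⟩

theorem degLT_mono {m m' : ℕ} (h : m ≤ m') : degLT q m ≤ degLT q m' :=
  Submodule.span_mono fun _ ⟨n, j, hj, e⟩ => ⟨n, j, hj.trans_le h, e⟩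

theorem E_mem_degLT {a b : ℤ} {m : ℕ} (h : b - a < m) : E q a b ∈ degLT q m := by
  by_cases hab : a ≤ b
  · obtain ⟨j, rfl⟩ := Int.le.dest hab
    rw [E_add]
    exact Submodule.smul_mem _ _ (mon_mem_degLT (by omega) a)
  · rw [E_eq_zero q (not_le.1 hab)]
    exact Submodule.zero_mem _

theorem exists_mem_degLT (h : H q) : ∃ m, h ∈ degLT q m := by
  have : h ∈ Submodule.span k (Set.range fun p : ℤ × ℕ => mon q p.1 p.2) := span_mon q trivial
  induction this using Submodule.span_induction with
  | mem h hh =>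
    obtain ⟨⟨n, m⟩, rfl⟩ := hh
    exact ⟨m + 1, mon_mem_degLT m.lt_succ_self n⟩
  | zero => exact ⟨0, Submodule.zero_mem _⟩
  | add a b _ _ ha hb =>
    obtain ⟨m, hm⟩ := ha
    obtain ⟨m', hm'⟩ := hb
    exact ⟨max m m', Submodule.add_mem _ (degLT_mono (le_max_left _ _) hm)
      (degLT_mono (le_max_right _ _) hm')⟩
  | smul c a _ ha =>
    obtain ⟨m, hm⟩ := ha
    exact ⟨m, Submodule.smul_mem _ c hm⟩

theorem eqOn_degLT {M : Type*} [AddCommMonoid M] [Module k M] {f g : H q →ₗ[k] M} {m : ℕ}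
    (h : ∀ n j, j < m → f (mon q n j) = g (mon q n j)) {z : H q} (hz : z ∈ degLT q m) :
    f z = g z :=
  LinearMap.eqOn_span (f := f) (g := g) (by rintro _ ⟨n, j, hj, rfl⟩; exact h n j hj) hz

/-- `S` differs from the identity by a map that lowers the degree. -/
def IsUnipotent (S : H q →ₗ[k] H q) : Prop := ∀ n m, S (mon q n m) - mon q n m ∈ degLT q m

theorem IsUnipotent.sub_mem {S : H q →ₗ[k] H q} (hS : IsUnipotent S) {m : ℕ} {z : H q}
    (hz : z ∈ degLT q (m + 1)) : S z - z ∈ degLT q m := by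
  have : degLT q (m + 1) ≤ (degLT q m).comap (S - LinearMap.id) := by
    refine Submodule.span_le.2 ?_
    rintro _ ⟨n, j, hj, rfl⟩
    exact degLT_mono (Nat.lt_succ_iff.1 hj) (hS n j)
  exact this hz

theorem IsUnipotent.map_mem {S : H q →ₗ[k] H q} (hS : IsUnipotent S) {m : ℕ} {z : H q}
    (hz : z ∈ degLT q m) : S z ∈ degLT q m := by
  have h := Submodule.add_mem _ (degLT_mono (Nat.sub_le m 1)
    (hS.sub_mem (m := m - 1) (degLT_mono (by omega) hz))) hz
  rwa [sub_add_cancel] at h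

theorem isUnipotent_id : IsUnipotent (LinearMap.id : H q →ₗ[k] H q) := fun n m => by simp

theorem IsUnipotent.comp {S T : H q →ₗ[k] H q} (hS : IsUnipotent S) (hT : IsUnipotent T) :
    IsUnipotent (S ∘ₗ T) := fun n m => by
  have h1 := hS.map_mem (hT n m)
  have h2 := Submodule.add_mem _ h1 (hS n m)
  rwa [map_sub, sub_add_sub_cancel] at h2

/-- A unipotent map is `1 - T` with `T` locally nilpotent. -/
theorem IsUnipotent.bijective {S : H q →ₗ[k] H q} (hS : IsUnipotent S) :
    Function.Bijective S := by
  set T : Module.End k (H q) := 1 - S with hT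
  have hpow : ∀ m (z : H q), z ∈ degLT q m → (T ^ m) z = 0 := by
    intro m
    induction m with
    | zero =>
      intro z hz
      have : degLT q 0 = ⊥ := by simp [degLT]
      rw [this, Submodule.mem_bot] at hz
      simp [hz]
    | succ m ih =>
      intro z hz
      rw [pow_succ, Module.End.mul_apply]
      apply ih
      have := Submodule.neg_mem _ (hS.sub_mem hz)
      simpa [hT] using this
  constructor
  · rw [← LinearMap.ker_eq_bot, LinearMap.ker_eq_bot']
    intro z hz
    obtain ⟨m, hm⟩ := exists_mem_degLT z
    have h1 : T z = z := by simp [hT, hz]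
    have h2 : (T ^ m) z = z := by
      rw [Module.End.pow_apply]
      exact Function.iterate_fixed h1 m
    rw [← h2, hpow m z hm]
  · intro z
    obtain ⟨m, hm⟩ := exists_mem_degLT z
    refine ⟨(∑ i ∈ Finset.range m, T ^ i) z, ?_⟩
    have h1 : S * ∑ i ∈ Finset.range m, T ^ i = 1 - T ^ m := by
      rw [← mul_neg_geom_sum]
      simp [hT]
    have h2 := LinearMap.congr_fun h1 z
    rwa [Module.End.mul_apply, LinearMap.sub_apply, hpow m z hm, sub_zero] at h2

end

/-! ### The maps `phiS` as inner automorphisms -/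

section

/-- The action on `H`, from the side of the left end of the intervals, of the element `1 - N` of the
incidence algebra of `ℤ`, where `N` takes the value `N a` at `[a, a + s]` and vanishes elsewhere:
`E a b ↦ E a b - N a • E (a + s) b`. -/
def leftEndOp (q : kˣ) (s : ℕ) (N : ℤ → k) : H q →ₗ[k] H q :=
  ofMon q fun n m => qFac (q : k) m • (E q n (n + m) - N n • E q (n + s) (n + m))

/-- The action of the same element from the side of the right end of the intervals:
`E a b ↦ E a b - N (b - s) • E a (b - s)`. -/
def rightEndOp (q : kˣ) (s : ℕ) (N : ℤ → k) : H q →ₗ[k] H q :=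
  ofMon q fun n m => qFac (q : k) m • (E q n (n + m) - N (n + m - s) • E q n (n + m - s))

variable {q : kˣ} (hq : ∀ n : ℕ, 0 < n → (q : k) ^ n ≠ 1) (s : ℕ) (N : ℤ → k)
include hq

theorem leftEndOp_E (a b : ℤ) :
    leftEndOp q s N (E q a b) = E q a b - N a • E q (a + s) b := by
  by_cases hab : a ≤ b
  · obtain ⟨m, rfl⟩ := Int.le.dest hab
    nth_rewrite 1 [E_add]
    rw [map_smul, leftEndOp, ofMon_mon, inv_smul_smul₀ (qFac_ne_zero hq m)]
  · rw [E_eq_zero q (by omega), E_eq_zero q (by omega), map_zero, smul_zero, sub_zero]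

theorem rightEndOp_E (a b : ℤ) :
    rightEndOp q s N (E q a b) = E q a b - N (b - s) • E q a (b - s) := by
  by_cases hab : a ≤ b
  · obtain ⟨m, rfl⟩ := Int.le.dest hab
    nth_rewrite 1 [E_add]
    rw [map_smul, rightEndOp, ofMon_mon, inv_smul_smul₀ (qFac_ne_zero hq m)]
  · rw [E_eq_zero q (by omega), E_eq_zero q (by omega), map_zero, smul_zero, sub_zero]

theorem leftEndOp_comm_rightEndOp :
    leftEndOp q s N ∘ₗ rightEndOp q s N = rightEndOp q s N ∘ₗ leftEndOp q s N := by
  refine ext_E hq fun a b _ => ?_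
  simp only [LinearMap.comp_apply, leftEndOp_E hq, rightEndOp_E hq, map_sub, map_smul, smul_sub,
    smul_smul]
  rw [mul_comm (N a)]
  abel

theorem isUnipotent_leftEndOp (hs : 0 < s) : IsUnipotent (leftEndOp q s N) := by
  intro n m
  rw [mon_eq_E hq, map_smul, leftEndOp_E hq, ← smul_sub, sub_sub_cancel_left]
  exact Submodule.smul_mem _ _ (Submodule.neg_mem _ (Submodule.smul_mem _ _
    (E_mem_degLT (by omega))))

theorem counit_leftEndOp :
    counit (R := k) ∘ₗ leftEndOp q s N = counit ∘ₗ rightEndOp q s N := by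
  refine ext_E hq fun a b _ => ?_
  simp only [LinearMap.comp_apply, leftEndOp_E hq, rightEndOp_E hq, map_sub, map_smul, counit_E]
  by_cases h : a + s = b
  · rw [if_pos h, if_pos (c := a = b - s) (by omega), show b - s = a by omega]
  · rw [if_neg h, if_neg (c := a = b - s) (by omega), smul_zero, smul_zero]

theorem comul_leftEndOp :
    comul ∘ₗ leftEndOp q s N = (leftEndOp q s N).rTensor (H q) ∘ₗ comul := by
  refine ext_E hq fun a b _ => ?_
  simp only [LinearMap.comp_apply, leftEndOp_E hq, map_sub, map_smul, comul_E hq, map_sum,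
    LinearMap.rTensor_tmul, TensorProduct.sub_tmul, Finset.sum_sub_distrib,
    ← TensorProduct.smul_tmul', ← Finset.smul_sum]
  congr 2
  refine Finset.sum_subset (Finset.Icc_subset_Icc_left (by omega)) fun c hc hc' => ?_
  simp only [Finset.mem_Icc] at hc hc'
  rw [E_eq_zero q (by omega), TensorProduct.zero_tmul]

theorem comul_rightEndOp :
    comul ∘ₗ rightEndOp q s N = (rightEndOp q s N).lTensor (H q) ∘ₗ comul := by
  refine ext_E hq fun a b _ => ?_
  simp only [LinearMap.comp_apply, rightEndOp_E hq, map_sub, map_smul, comul_E hq, map_sum,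
    LinearMap.lTensor_tmul, TensorProduct.tmul_sub, Finset.sum_sub_distrib,
    TensorProduct.tmul_smul, ← Finset.smul_sum]
  congr 2
  refine Finset.sum_subset (Finset.Icc_subset_Icc_right (by omega)) fun c hc hc' => ?_
  simp only [Finset.mem_Icc] at hc hc'
  rw [E_eq_zero q (a := c) (by omega), TensorProduct.tmul_zero]

/-- The two actions are balanced over the comultiplication. -/
theorem rTensor_rightEndOp_comul :
    (rightEndOp q s N).rTensor (H q) ∘ₗ comul = (leftEndOp q s N).lTensor (H q) ∘ₗ comul := by
  refine ext_E hq fun a b _ => ?_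
  simp only [LinearMap.comp_apply, comul_E hq, map_sum, LinearMap.lTensor_tmul,
    LinearMap.rTensor_tmul, rightEndOp_E hq, leftEndOp_E hq, TensorProduct.sub_tmul,
    TensorProduct.tmul_sub, Finset.sum_sub_distrib]
  congr 1
  refine Finset.sum_bij_ne_zero (fun c _ _ => c - s) ?_ ?_ ?_ ?_
  · intro c hc h0
    simp only [Finset.mem_Icc] at hc ⊢
    by_contra hcon
    rw [E_eq_zero q (b := c - s) (by omega), smul_zero, TensorProduct.zero_tmul] at h0
    exact h0 rfl
  · intro c _ _ d _ _ h
    simpa using h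
  · intro c hc h0
    have hcb : c + s ≤ b := by
      by_contra hcon
      rw [E_eq_zero q (a := c + s) (by omega), smul_zero, TensorProduct.tmul_zero] at h0
      exact h0 rfl
    simp only [Finset.mem_Icc] at hc
    refine ⟨c + s, Finset.mem_Icc.2 (by omega), ?_, by simp⟩
    rwa [add_sub_cancel_right, TensorProduct.smul_tmul]
  · intro c _ _
    rw [sub_add_cancel, TensorProduct.smul_tmul]

omit hq in
theorem stepProd_mul_const (β : ℤ → k) (c : k) (n : ℤ) (s l : ℕ) :
    stepProd (fun n => β n * c) n s l = stepProd β n s l * c ^ l := by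
  simp [stepProd, Finset.prod_mul_distrib]

/-- The map `phiS` in the basis of intervals: its summands form two telescoping families. -/
theorem phiS_mon (β N : ℤ → k) (hN : ∀ n, N n = β n * (qFac (q : k) s)⁻¹)
    (n : ℤ) (m : ℕ) :
    phiS q s β (mon q n m) = qFac (q : k) m •
      (∑ i ∈ Finset.range (m / s + 1), stepProd N n s i • E q (n + i * s) (n + m) -
        N (n + m - s) •
          ∑ i ∈ Finset.range (m / s), stepProd N n s i • E q (n + i * s) (n + m - s)) := by
  obtain rfl : N = fun n => β n * (qFac (q : k) s)⁻¹ := funext hN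
  rw [phiS, ofMon_mon, Finset.sum_range_succ', add_sub_right_comm (Finset.sum _ _),
    Finset.smul_sum, ← Finset.sum_sub_distrib, smul_add, Finset.smul_sum, add_comm (mon q n m)]
  congr 1
  · refine Finset.sum_congr rfl fun i hi => ?_
    have him : (i + 1) * s ≤ m :=
      (Nat.mul_le_mul_right s (Finset.mem_range.1 hi)).trans (Nat.div_mul_le_self m s)
    obtain ⟨j, rfl⟩ := Nat.exists_eq_add_of_le him
    have h1 : qBinomProd (q : k) ((i + 1) * s + j) s (i + 1) * qFac (q : k) j =
        qFac (q : k) ((i + 1) * s + j) * (qFac (q : k) s)⁻¹ ^ (i + 1) := by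
      rw [← qBinomProd_mul_qFac (q : k) him, Nat.add_sub_cancel_left]
      rw [inv_pow, eq_mul_inv_iff_mul_eq₀ (pow_ne_zero _ (qFac_ne_zero hq s))]
      ring
    have h2 : n + ((i : ℤ) + 1) * s + j = n + (((i + 1) * s + j : ℕ) : ℤ) := by push_cast; ring
    have h3 : n + (i : ℤ) * s + j = n + (((i + 1) * s + j : ℕ) : ℤ) - s := by push_cast; ring
    rw [Nat.add_sub_cancel_left, mon_eq_E hq, mon_eq_E hq, h2, h3, stepProd_mul_const,
      stepProd_mul_const, Nat.cast_succ]
    simp only [smul_sub, smul_smul]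
    congr 2
    · linear_combination stepProd β n s (i + 1) * h1
    · rw [pow_succ] at h1
      linear_combination (stepProd β n s i * β (n + (((i + 1) * s + j : ℕ) : ℤ) - s)) * h1
  · rw [mon_eq_E hq]
    simp [stepProd]

/-- `phiS` is the quotient of the right-end action by the left-end action of the same element of the
incidence algebra; this makes it the coalgebra form of an inner automorphism. -/
theorem leftEndOp_comp_phiS (hs : 0 < s) (β N : ℤ → k)
    (hN : ∀ n, N n = β n * (qFac (q : k) s)⁻¹) :
    leftEndOp q s N ∘ₗ phiS q s β = rightEndOp q s N := by
  have htel : ∀ n b l, leftEndOp q s N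
      (∑ i ∈ Finset.range l, stepProd N n s i • E q (n + i * s) b) =
      E q n b - stepProd N n s l • E q (n + l * s) b := by
    intro n b l
    rw [map_sum]
    have : ∀ i, leftEndOp q s N (stepProd N n s i • E q (n + i * s) b) =
        stepProd N n s i • E q (n + i * s) b -
          stepProd N n s (i + 1) • E q (n + (i + 1 : ℕ) * s) b := by
      intro i
      rw [map_smul, leftEndOp_E hq, smul_sub, smul_smul, stepProd, stepProd,
        Finset.prod_range_succ, Nat.cast_succ, add_mul, one_mul, add_assoc]
    simp only [this]
    rw [Finset.sum_range_sub' (fun i : ℕ => stepProd N n s i • E q (n + i * s) b)]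
    simp [stepProd]
  refine ext_mon q fun n m => ?_
  have hlt : m < (m / s + 1) * s := by
    rw [add_mul, one_mul]
    exact Nat.lt_div_mul_add hs
  have hlt' : (m : ℤ) < (m / s + 1 : ℕ) * s := by exact_mod_cast hlt
  rw [LinearMap.comp_apply, phiS_mon hq s β N hN, map_smul, map_sub, map_smul, htel, htel,
    E_eq_zero q (a := n + (m / s + 1 : ℕ) * s) (by omega)]
  rw [Nat.cast_succ, add_mul, one_mul] at hlt'
  rw [E_eq_zero q (a := n + (m / s : ℕ) * s) (by omega), smul_zero, smul_zero, sub_zero, sub_zero,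
    ← rightEndOp_E hq, ← map_smul, ← mon_eq_E hq]

omit hq in
theorem phiS_mon_of_lt (β : ℤ → k) (n : ℤ) {m : ℕ} (h : m < s) :
    phiS q s β (mon q n m) = mon q n m := by
  rw [phiS, ofMon_mon, Nat.div_eq_of_lt h, Finset.sum_range_zero, add_zero]

theorem phiS_mon_self (hs : 0 < s) (β : ℤ → k) (n : ℤ) :
    phiS q s β (mon q n s) = mon q n s + β n • (mon q (n + s) 0 - mon q n 0) := by
  have h : qBinom (q : k) s s = 1 := by
    have := qBinom_mul_qFac (q : k) s 0
    rw [qFac_zero, mul_one, add_zero] at this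
    exact mul_right_cancel₀ (qFac_ne_zero hq s) (this.trans (one_mul _).symm)
  rw [phiS, ofMon_mon, Nat.div_self hs]
  simp [qBinomProd, stepProd, h, smul_sub]

omit hq in
theorem isUnipotent_phiS (hs : 0 < s) (β : ℤ → k) : IsUnipotent (phiS q s β) := by
  intro n m
  rw [phiS, ofMon_mon, add_sub_cancel_left]
  refine Submodule.sum_mem _ fun i hi => Submodule.smul_mem _ _ ?_
  have him : (i + 1) * s ≤ m :=
    (Nat.mul_le_mul_right s (Finset.mem_range.1 hi)).trans (Nat.div_mul_le_self m s)
  have : 0 < (i + 1) * s := by positivity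
  exact Submodule.sub_mem _ (Submodule.smul_mem _ _ (mon_mem_degLT (by omega) _))
    (Submodule.smul_mem _ _ (mon_mem_degLT (by omega) _))

/-- With `L` and `R` the left-end and right-end actions and `L S = R`, the identities
`Δ L = (L ⊗ 1) Δ`, `Δ R = (1 ⊗ R) Δ`, `(R ⊗ 1) Δ = (1 ⊗ L) Δ` and `L R = R L` give
`(L ⊗ 1) (S ⊗ S) Δ = (L ⊗ 1) Δ S`, where `L ⊗ 1` is injective. -/
theorem comul_phiS (hs : 0 < s) (β : ℤ → k) :
    TensorProduct.map (phiS q s β) (phiS q s β) ∘ₗ comul = comul ∘ₗ phiS q s β := by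
  set N : ℤ → k := fun n => β n * (qFac (q : k) s)⁻¹ with hN
  set S := phiS q s β
  set L := leftEndOp q s N
  set R := rightEndOp q s N
  have hLS : L ∘ₗ S = R := leftEndOp_comp_phiS hq s hs β N fun _ => rfl
  have hinj : Function.Injective L := (isUnipotent_leftEndOp hq s N hs).bijective.1
  have hSL : S ∘ₗ L = R := by
    rw [← LinearMap.cancel_left hinj, ← LinearMap.comp_assoc, hLS]
    exact (leftEndOp_comm_rightEndOp hq s N).symm
  have hinj' : Function.Injective (L.rTensor (H q)) :=
    Module.Flat.rTensor_preserves_injective_linearMap _ hinj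
  rw [← LinearMap.cancel_left hinj']
  calc L.rTensor (H q) ∘ₗ (TensorProduct.map S S ∘ₗ comul)
      = (S.lTensor (H q) ∘ₗ (L ∘ₗ S).rTensor (H q)) ∘ₗ comul := by
        rw [← LinearMap.comp_assoc, LinearMap.rTensor_comp_map, LinearMap.lTensor_comp_rTensor]
    _ = S.lTensor (H q) ∘ₗ (L.lTensor (H q) ∘ₗ comul) := by
        rw [hLS, LinearMap.comp_assoc, rTensor_rightEndOp_comul hq s N]
    _ = comul ∘ₗ (L ∘ₗ S) := by
        rw [← LinearMap.comp_assoc, ← LinearMap.lTensor_comp, hSL, hLS, comul_rightEndOp hq s N]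
    _ = L.rTensor (H q) ∘ₗ (comul ∘ₗ S) := by
        rw [← LinearMap.comp_assoc, comul_leftEndOp hq s N, LinearMap.comp_assoc]

theorem counit_phiS (hs : 0 < s) (β : ℤ → k) : counit (R := k) ∘ₗ phiS q s β = counit := by
  set N : ℤ → k := fun n => β n * (qFac (q : k) s)⁻¹ with hN
  have hLS := leftEndOp_comp_phiS hq s hs β N fun _ => rfl
  have hbij := (isUnipotent_leftEndOp hq s N hs).bijective
  have hSL : phiS q s β ∘ₗ leftEndOp q s N = rightEndOp q s N := by
    rw [← LinearMap.cancel_left hbij.1, ← LinearMap.comp_assoc, hLS]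
    exact (leftEndOp_comm_rightEndOp hq s N).symm
  rw [← LinearMap.cancel_right hbij.2, LinearMap.comp_assoc, hSL, counit_leftEndOp hq]

end

/-! ### The maps `bigPhi` -/

section

variable {q : kˣ}

theorem isUnipotent_phiComp (β : GInf k) (m : ℕ) : IsUnipotent (phiComp q β m) := by
  induction m with
  | zero => exact isUnipotent_id
  | succ m ih => exact ih.comp (isUnipotent_phiS _ m.succ_pos _)

theorem phiComp_mon_of_le (β : GInf k) (n : ℤ) {m m' : ℕ} (h : m ≤ m') :
    phiComp q β m' (mon q n m) = phiComp q β m (mon q n m) := by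
  induction m', h using Nat.le_induction with
  | base => rfl
  | succ m' h ih =>
    rw [phiComp, LinearMap.comp_apply, phiS_mon_of_lt _ _ _ (Nat.lt_succ_of_le h), ih]

theorem phiComp_mon_zero (β : GInf k) (n : ℤ) (m : ℕ) :
    phiComp q β m (mon q n 0) = mon q n 0 :=
  phiComp_mon_of_le β n m.zero_le

theorem phiComp_congr {β γ : GInf k} {m : ℕ} (h : ∀ i : ℕ, i < m → β i.succPNat = γ i.succPNat) :
    phiComp q β m = phiComp q γ m := by
  induction m with
  | zero => rfl
  | succ m ih => rw [phiComp, phiComp, ih fun i hi => h i (hi.trans m.lt_succ_self),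
      h m m.lt_succ_self]

theorem bigPhi_mon (β : GInf k) (n : ℤ) (m : ℕ) :
    bigPhi q β (mon q n m) = phiComp q β m (mon q n m) := ofMon_mon q _ n m

theorem bigPhi_eq_phiComp (β : GInf k) {m : ℕ} {z : H q} (hz : z ∈ degLT q (m + 1)) :
    bigPhi q β z = phiComp q β m z :=
  eqOn_degLT (fun n j hj => by rw [bigPhi_mon, phiComp_mon_of_le β n (Nat.lt_succ_iff.1 hj)]) hz

theorem isUnipotent_bigPhi (β : GInf k) : IsUnipotent (bigPhi q β) := fun n m => by
  rw [bigPhi_mon]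
  exact isUnipotent_phiComp β m n m

variable (hq : ∀ n : ℕ, 0 < n → (q : k) ^ n ≠ 1)
include hq

theorem phiComp_succ_mon (β : GInf k) (n : ℤ) (m : ℕ) :
    phiComp q β (m + 1) (mon q n (m + 1)) = phiComp q β m (mon q n (m + 1)) +
      β m.succPNat n • (mon q (n + (m + 1 : ℕ)) 0 - mon q n 0) := by
  rw [phiComp, LinearMap.comp_apply, phiS_mon_self hq _ m.succ_pos, map_add, map_smul, map_sub,
    phiComp_mon_zero, phiComp_mon_zero]

theorem bigPhi_mon_one (β : GInf k) (n : ℤ) :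
    bigPhi q β (mon q n 1) = mon q n 1 + β 1 n • (mon q (n + 1) 0 - mon q n 0) := by
  rw [bigPhi_mon, phiComp_succ_mon hq β n 0]
  rfl

omit hq in
variable (q) in
/-- The composite `phiComp` as a coalgebra endomorphism. -/
def phiCompHom (hq : ∀ n : ℕ, 0 < n → (q : k) ^ n ≠ 1) (β : GInf k) (m : ℕ) : H q →ₗc[k] H q where
  toLinearMap := phiComp q β m
  counit_comp := by
    induction m with
    | zero => rfl
    | succ m ih => rw [phiComp, ← LinearMap.comp_assoc, ih, counit_phiS hq _ m.succ_pos]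
  map_comp_comul := by
    induction m with
    | zero => simp [phiComp]
    | succ m ih =>
      rw [phiComp, TensorProduct.map_comp, LinearMap.comp_assoc, comul_phiS hq _ m.succ_pos,
        ← LinearMap.comp_assoc, ih, LinearMap.comp_assoc]

omit hq in
variable (q) in
/-- The map `bigPhi` as a coalgebra endomorphism: on a given degree it agrees with one of the
composites `phiComp`. -/
def bigPhiHom (hq : ∀ n : ℕ, 0 < n → (q : k) ^ n ≠ 1) (β : GInf k) : H q →ₗc[k] H q where
  toLinearMap := bigPhi q β
  counit_comp := by
    refine ext_mon q fun n m => ?_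
    rw [LinearMap.comp_apply, bigPhi_mon]
    exact CoalgHomClass.counit_comp_apply (phiCompHom q hq β m) _
  map_comp_comul := by
    refine ext_mon q fun n m => ?_
    rw [LinearMap.comp_apply, LinearMap.comp_apply, bigPhi_mon]
    refine Eq.trans ?_ (CoalgHomClass.map_comp_comul_apply (phiCompHom q hq β m) _)
    rw [comul_mon, map_sum, map_sum]
    refine Finset.sum_congr rfl fun i hi => ?_
    have hi' := Finset.mem_range.1 hi
    rw [map_smul, map_smul, TensorProduct.map_tmul, TensorProduct.map_tmul,
      bigPhi_eq_phiComp β (m := m) (mon_mem_degLT (by omega) n),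
      bigPhi_eq_phiComp β (m := m) (mon_mem_degLT (by omega) _)]
    rfl

omit hq in
variable (q) in
/-- The map `bigPhi` as a coalgebra automorphism. -/
def bigPhiAut (hq : ∀ n : ℕ, 0 < n → (q : k) ^ n ≠ 1) (β : GInf k) : AutC q :=
  CoalgEquiv.ofBijective (f := bigPhiHom q hq β) (isUnipotent_bigPhi β).bijective

theorem bigPhiAut_apply (β : GInf k) (h : H q) : bigPhiAut q hq β h = bigPhi q β h := rfl

theorem bigPhiAut_injective : Function.Injective (bigPhiAut q hq) := by
  intro β γ h
  have hmon : ∀ n m, phiComp q β m (mon q n m) = phiComp q γ m (mon q n m) := by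
    intro n m
    rw [← bigPhi_mon, ← bigPhi_mon, ← bigPhiAut_apply hq, h, bigPhiAut_apply]
  have key : ∀ i : ℕ, β i.succPNat = γ i.succPNat := by
    intro i
    induction i using Nat.strong_induction_on with
    | _ i ih =>
      funext n
      have h1 := hmon n (i + 1)
      rw [phiComp_succ_mon hq, phiComp_succ_mon hq, phiComp_congr ih, add_right_inj] at h1
      refine smul_left_injective k ?_ h1
      rw [sub_ne_zero]
      intro h2
      have := mon_zero_injective q h2
      omega
  funext i
  rw [← PNat.succPNat_natPred i, key]

/-! ### The group `AutStar` -/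

omit hq in
theorem AutC.mul_apply (φ ψ : AutC q) (h : H q) : (φ * ψ) h = φ (ψ h) := rfl

omit hq in
theorem AutC.inv_apply_self (φ : AutC q) (h : H q) : φ⁻¹ (φ h) = h := φ.symm_apply_apply h

theorem exists_apply_mon_zero (φ : AutC q) (n : ℤ) : ∃ r, φ (mon q n 0) = mon q r 0 :=
  eq_mon_of_isGroupLikeElem hq ((isGroupLikeElem_mon q n).map φ)

/-- If `φ (xⁿ)` and `φ (xⁿ⁺¹)` are `xᵃ` and `xᵇ`, then `φ (xⁿ y)` is skew-primitive for the pair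
`(xᵃ, xᵇ)`, with a nonzero component at `E a b`, since `φ⁻¹` preserves the span of the powers
of `x`. -/
theorem apply_mon_one (φ : AutC q) {n a b : ℤ} (ha : φ (mon q n 0) = mon q a 0)
    (hb : φ (mon q (n + 1) 0) = mon q b 0) :
    ∃ c d : k, c ≠ 0 ∧ a < b ∧
      φ (mon q n 1) = c • E q a b + d • (mon q b 0 - mon q a 0) := by
  have hab : a ≠ b := by
    rintro rfl
    have := mon_zero_injective q (φ.injective (ha.trans hb.symm))
    omega
  have hsk := comul_apply_mon_one hq (φ : H q →ₗc[k] H q) n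
  simp only [CoalgEquiv.coe_coe, ha, hb] at hsk
  have h := skewPrimitive hq hab hsk
  set c := coef q a b (φ (mon q n 1))
  set d := coef q b b (φ (mon q n 1))
  have hne : c • E q a b ≠ 0 := by
    intro h0
    rw [h0, zero_add, ← hb, ← ha, ← map_sub, ← map_smul] at h
    have h1 := congrArg (coef q n (n + 1)) (φ.injective h)
    rw [← E_succ, coef_E hq, map_smul, map_sub, coef_mon_zero hq, coef_mon_zero hq,
      if_pos (by omega), if_neg (by omega), if_neg (by omega), sub_zero, smul_zero] at h1
    exact one_ne_zero h1
  refine ⟨c, d, left_ne_zero_of_smul hne, ?_, h⟩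
  by_contra hlt
  exact right_ne_zero_of_smul hne (E_eq_zero q (by omega))

theorem apply_mon_zero_of_mem_autStar {φ : AutC q} (hφ : φ ∈ AutStar q) (n : ℤ) :
    φ (mon q n 0) = mon q n 0 := by
  obtain ⟨-, β, hβ⟩ := hφ
  obtain ⟨a, ha⟩ := exists_apply_mon_zero hq φ n
  obtain ⟨b, hb⟩ := exists_apply_mon_zero hq φ (n + 1)
  obtain ⟨c, d, -, hlt, h⟩ := apply_mon_one hq φ ha hb
  have h1 := congrArg (coef q n (n + 1)) ((hβ n).symm.trans h)
  rw [← E_succ] at h1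
  simp only [map_add, map_sub, map_smul, coef_E hq, coef_mon_zero hq, smul_eq_mul] at h1
  by_contra hne
  have han : a ≠ n := by
    rintro rfl
    exact hne ha
  simp [han, show ¬(b = n ∧ b = n + 1) by omega] at h1

/-- `AutStar` as a subgroup of the group of coalgebra automorphisms. -/
def autStarSubgroup (hq : ∀ n : ℕ, 0 < n → (q : k) ^ n ≠ 1) : Subgroup (AutC q) where
  carrier := AutStar q
  one_mem' := ⟨(Aut0 q).one_mem, 0, fun n => by simp; rfl⟩
  mul_mem' {φ ψ} hφ hψ := by
    have h0 := apply_mon_zero_of_mem_autStar hq hφ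
    obtain ⟨hφ0, β, hβ⟩ := hφ
    obtain ⟨hψ0, γ, hγ⟩ := hψ
    refine ⟨(Aut0 q).mul_mem hφ0 hψ0, β + γ, fun n => ?_⟩
    change φ (ψ _) = _
    rw [hγ, map_add, map_smul, map_sub, h0, h0, hβ, add_assoc, ← add_smul]
    rfl
  inv_mem' {φ} hφ := by
    have h0 := apply_mon_zero_of_mem_autStar hq hφ
    obtain ⟨hφ0, β, hβ⟩ := hφ
    refine ⟨(Aut0 q).inv_mem hφ0, -β, fun n => φ.injective ?_⟩
    change φ (φ.symm _) = φ _
    rw [φ.apply_symm_apply, map_add, map_smul, map_sub, h0, h0, hβ, add_assoc,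
      ← add_smul, Pi.neg_apply, add_neg_cancel, zero_smul, add_zero]

theorem bigPhiAut_mem_autStar (β : GInf k) : bigPhiAut q hq β ∈ AutStar q := by
  refine ⟨?_, β 1, bigPhi_mon_one hq β⟩
  change bigPhi q β 1 = 1
  rw [← mon_zero_zero, bigPhi_mon]
  rfl

omit hq in
/-- A sequence can be prescribed recursively, by a rule `F` for its `(m + 1)`-st term that depends
on the first `m` terms only. -/
theorem exists_recursive (F : ℕ → GInf k → ℤ → k)
    (hF : ∀ m β γ, (∀ i < m, β i.succPNat = γ i.succPNat) → F m β = F m γ) :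
    ∃ β : GInf k, ∀ m : ℕ, β m.succPNat = F m β := by
  let g : ℕ → GInf k := fun m => Nat.rec (fun _ _ => 0)
    (fun m g => Function.update (β := fun _ : ℕ+ => ℤ → k) g m.succPNat (F m g)) m
  have hg : ∀ m, g (m + 1) =
      Function.update (β := fun _ : ℕ+ => ℤ → k) (g m) m.succPNat (F m (g m)) := fun _ => rfl
  have hstable : ∀ i m, i < m → g m i.succPNat = F i (g i) := by
    intro i m him
    induction m, him using Nat.le_induction with
    | base => rw [hg]; exact Function.update_self ..
    | succ m him ih =>
      rw [hg]
      refine (Function.update_of_ne ?_ _ _).trans ih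
      intro h
      have : i = m := Nat.succPNat_injective h
      omega
  refine ⟨fun j => g (j.natPred + 1) j, fun m => ?_⟩
  change g (m.succPNat.natPred + 1) m.succPNat = _
  rw [Nat.natPred_succPNat, hstable _ _ m.lt_succ_self]
  refine hF _ _ _ fun i hi => ?_
  rw [Nat.natPred_succPNat, hstable _ _ hi, hstable _ _ i.lt_succ_self]

/-- Every element of `AutStar` is a `bigPhi`: the parameters are found one degree at a time, since
two coalgebra endomorphisms that agree in lower degrees differ by a skew-primitive element. -/
theorem exists_bigPhiAut_eq {φ : AutC q} (hφ : φ ∈ AutStar q) : ∃ β, bigPhiAut q hq β = φ := by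
  have h0 := apply_mon_zero_of_mem_autStar hq hφ
  obtain ⟨β, hβ⟩ := exists_recursive
    (fun m β n => coef q (n + (m + 1 : ℕ)) (n + (m + 1 : ℕ))
      (φ (mon q n (m + 1)) - phiComp q β m (mon q n (m + 1))))
    (fun m β γ h => by simp only [phiComp_congr h])
  have key : ∀ m n, φ (mon q n m) = phiComp q β m (mon q n m) := by
    intro m
    induction m using Nat.strong_induction_on with
    | _ m ih =>
      intro n
      obtain _ | m := m
      · rw [h0]; rfl
      rw [phiComp_succ_mon hq, ← sub_eq_iff_eq_add', hβ m]
      obtain _ | m := m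
      · obtain ⟨-, γ, hγ⟩ := hφ
        have h1 : φ (mon q n (0 + 1)) - phiComp q β 0 (mon q n (0 + 1)) =
            γ n • (mon q (n + (0 + 1 : ℕ)) 0 - mon q n 0) := by
          rw [zero_add, hγ]
          simp [phiComp]
        beta_reduce
        rw [h1, map_smul, map_sub, coef_mon_zero hq, coef_mon_zero hq]
        simp
      · refine sub_eq_of_agree hq (φ := φ) (ψ := phiCompHom q hq β (m + 1)) (by omega) h0
          (fun n j hj => ?_) n
        exact (ih j hj n).trans (phiComp_mon_of_le β n (Nat.lt_succ_iff.1 hj)).symm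
  refine ⟨β, CoalgEquiv.ext fun h => ?_⟩
  have : (bigPhiAut q hq β : H q →ₗc[k] H q).toLinearMap = (φ : H q →ₗc[k] H q).toLinearMap :=
    ext_mon q fun n m => ((key m n).trans (bigPhi_mon β n m).symm).symm
  exact LinearMap.congr_fun this h

/-! ### The group structure on `GInf` -/

omit hq in
variable (q) in
/-- The bijection from `GInf` to the group `AutStar`. -/
def gInfEquiv (hq : ∀ n : ℕ, 0 < n → (q : k) ^ n ≠ 1) : GInf k ≃ autStarSubgroup hq :=
  Equiv.ofBijective (fun β => ⟨bigPhiAut q hq β, bigPhiAut_mem_autStar hq β⟩)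
    ⟨fun _ _ h => bigPhiAut_injective hq (congrArg Subtype.val h), fun φ => by
      obtain ⟨β, hβ⟩ := exists_bigPhiAut_eq hq φ.2
      exact ⟨β, Subtype.ext hβ⟩⟩

omit hq in
variable (q) in
/-- The group structure on `GInf` transported from `AutStar`. -/
abbrev gInfGroup (hq : ∀ n : ℕ, 0 < n → (q : k) ^ n ≠ 1) : Group (GInf k) := (gInfEquiv q hq).group

omit hq in
variable (q) in
/-- The homomorphism `bigPhi` from `GInf` to the coalgebra automorphisms. -/
def gInfHom (hq : ∀ n : ℕ, 0 < n → (q : k) ^ n ≠ 1) :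
    letI := gInfGroup q hq
    GInf k →* AutC q :=
  letI := gInfGroup q hq
  (autStarSubgroup hq).subtype.comp (gInfEquiv q hq).mulEquiv.toMonoidHom

theorem gInfHom_apply (β : GInf k) :
    letI := gInfGroup q hq
    gInfHom q hq β = bigPhiAut q hq β := rfl

/-- If `bigPhi` sends `δ` to the composite of the images of `β` and `γ`, then `δ` is given by the
recursion. -/
theorem isProduct_of_comp {β γ δ : GInf k}
    (h : ∀ z, bigPhi q δ z = bigPhi q β (bigPhi q γ z)) : IsProduct q β γ δ := by
  constructor
  · intro n
    have h1 := h (mon q n 1)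
    rw [bigPhi_mon_one hq, bigPhi_mon_one hq, map_add, map_smul, map_sub, bigPhi_mon_one hq,
      bigPhi_mon, bigPhi_mon, phiComp_mon_zero, phiComp_mon_zero, add_assoc, ← add_smul,
      add_right_inj] at h1
    refine smul_left_injective k ?_ h1
    rw [sub_ne_zero]
    intro h2
    have := mon_zero_injective q h2
    omega
  · intro i _ n
    obtain ⟨m, rfl⟩ : ∃ m : ℕ, i = m.succPNat := ⟨i.natPred, (PNat.succPNat_natPred i).symm⟩
    have h1 := h (mon q n (m + 1))
    have h2 : phiComp q γ (m + 1) (mon q n (m + 1)) ∈ degLT q (m + 1 + 1) :=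
      (isUnipotent_phiComp γ _).map_mem (mon_mem_degLT (by omega) n)
    rw [bigPhi_mon, bigPhi_mon, bigPhi_eq_phiComp β h2, phiComp_succ_mon hq δ] at h1
    exact eq_sub_iff_add_eq'.2 h1

end

/-! ### The diagonal automorphisms and the shifts -/

section

variable (q : kˣ)

/-- The product `αₙ αₙ₊₁ ⋯ αₙ₊ₘ₋₁`, as an element of `k`. -/
def runProd (α : ℤ → kˣ) (n : ℤ) (m : ℕ) : k := ∏ i ∈ Finset.range m, (α (n + i) : k)

theorem runProd_add (α : ℤ → kˣ) (n : ℤ) (i j : ℕ) :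
    runProd α n (i + j) = runProd α n i * runProd α (n + i) j := by
  simp [runProd, Finset.prod_range_add, add_assoc]

theorem runProd_mul (α α' : ℤ → kˣ) (n : ℤ) (m : ℕ) :
    runProd (α * α') n m = runProd α n m * runProd α' n m := by
  simp [runProd, Finset.prod_mul_distrib]

theorem runProd_ne_zero (α : ℤ → kˣ) (n : ℤ) (m : ℕ) : runProd α n m ≠ 0 :=
  Finset.prod_ne_zero_iff.2 fun _ _ => Units.ne_zero _

theorem runProd_inv (α : ℤ → kˣ) (n : ℤ) (m : ℕ) :
    ∏ i ∈ Finset.range m, (((α (n + i))⁻¹ : kˣ) : k) = (runProd α n m)⁻¹ := by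
  simp [runProd]

theorem theta_mon (r n : ℤ) (m : ℕ) : theta q r (mon q n m) = mon q (n + r) m := ofMon_mon q _ n m

theorem phiAlpha_mon (α : ℤ → kˣ) (n : ℤ) (m : ℕ) :
    phiAlpha q α (mon q n m) = runProd α n m • mon q n m := ofMon_mon q _ n m

/-- The shift `theta` as a coalgebra endomorphism. -/
def thetaCoalgHom (r : ℤ) : H q →ₗc[k] H q where
  toLinearMap := theta q r
  counit_comp := ext_mon q fun n m => by simp [theta_mon, counit_mon]
  map_comp_comul := ext_mon q fun n m => by
    simp [theta_mon, comul_mon, add_right_comm]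

/-- The map `phiAlpha` as a coalgebra endomorphism. -/
def phiAlphaCoalgHom (α : ℤ → kˣ) : H q →ₗc[k] H q where
  toLinearMap := phiAlpha q α
  counit_comp := ext_mon q fun n m => by
    rcases m with _ | m <;> simp [phiAlpha_mon, counit_mon, runProd]
  map_comp_comul := ext_mon q fun n m => by
    simp only [LinearMap.comp_apply, comul_mon, map_sum, map_smul, TensorProduct.map_tmul,
      phiAlpha_mon, Finset.smul_sum]
    refine Finset.sum_congr rfl fun i hi => ?_
    obtain ⟨j, rfl⟩ := Nat.exists_eq_add_of_le (Nat.lt_succ_iff.1 (Finset.mem_range.1 hi))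
    rw [Nat.add_sub_cancel_left, TensorProduct.smul_tmul_smul, runProd_add, smul_comm]

theorem theta_add (r t : ℤ) : theta q (r + t) = theta q r ∘ₗ theta q t :=
  ext_mon q fun n m => by
    rw [LinearMap.comp_apply, theta_mon, theta_mon, theta_mon, add_comm r, add_assoc]

theorem theta_zero : theta q 0 = LinearMap.id :=
  ext_mon q fun n m => by rw [theta_mon, add_zero, LinearMap.id_apply]

/-- The homomorphism `r ↦ theta r` to the coalgebra automorphisms. -/
def thetaHom : Multiplicative ℤ →* AutC q where
  toFun r := CoalgEquiv.ofCoalgHom (thetaCoalgHom q r.toAdd) (thetaCoalgHom q (-r.toAdd))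
    (CoalgHom.coe_linearMap_injective (by
      change theta q r.toAdd ∘ₗ theta q (-r.toAdd) = _
      rw [← theta_add, add_neg_cancel, theta_zero]
      rfl))
    (CoalgHom.coe_linearMap_injective (by
      change theta q (-r.toAdd) ∘ₗ theta q r.toAdd = _
      rw [← theta_add, neg_add_cancel, theta_zero]
      rfl))
  map_one' := CoalgEquiv.ext (LinearMap.congr_fun (theta_zero q))
  map_mul' r t := CoalgEquiv.ext (LinearMap.congr_fun (theta_add q r.toAdd t.toAdd))

theorem phiAlpha_mul (α α' : ℤ → kˣ) : phiAlpha q (α * α') = phiAlpha q α ∘ₗ phiAlpha q α' :=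
  ext_mon q fun n m => by
    rw [LinearMap.comp_apply, phiAlpha_mon, phiAlpha_mon, map_smul, phiAlpha_mon, runProd_mul,
      smul_smul, mul_comm]

theorem phiAlpha_one : phiAlpha q (1 : ℤ → kˣ) = LinearMap.id :=
  ext_mon q fun n m => by simp [phiAlpha_mon, runProd]

/-- The homomorphism `α ↦ phiAlpha α` to the coalgebra automorphisms. -/
def phiAlphaHom : (ℤ → kˣ) →* AutC q where
  toFun α := CoalgEquiv.ofCoalgHom (phiAlphaCoalgHom q α) (phiAlphaCoalgHom q α⁻¹)
    (CoalgHom.coe_linearMap_injective (by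
      change phiAlpha q α ∘ₗ phiAlpha q α⁻¹ = _
      rw [← phiAlpha_mul, mul_inv_cancel, phiAlpha_one]
      rfl))
    (CoalgHom.coe_linearMap_injective (by
      change phiAlpha q α⁻¹ ∘ₗ phiAlpha q α = _
      rw [← phiAlpha_mul, inv_mul_cancel, phiAlpha_one]
      rfl))
  map_one' := CoalgEquiv.ext (LinearMap.congr_fun (phiAlpha_one q))
  map_mul' α α' := CoalgEquiv.ext (LinearMap.congr_fun (phiAlpha_mul q α α'))

/-- The homomorphism `(α, r) ↦ phiAlpha α ∘ theta r`. -/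
def monomialHom : (ℤ → kˣ) ⋊[shiftAction] Multiplicative ℤ →* AutC q :=
  SemidirectProduct.lift (phiAlphaHom q) (thetaHom q) fun r => by
    ext α : 1
    rw [MonoidHom.comp_apply, MonoidHom.comp_apply]
    change phiAlphaHom q (shiftAction r α) = thetaHom q r * phiAlphaHom q α * (thetaHom q r)⁻¹
    rw [eq_mul_inv_iff_mul_eq]
    have : phiAlpha q (shiftAction r α) ∘ₗ theta q r.toAdd =
        theta q r.toAdd ∘ₗ phiAlpha q α := ext_mon q fun n m => by
      rw [LinearMap.comp_apply, LinearMap.comp_apply, theta_mon, phiAlpha_mon, phiAlpha_mon,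
        map_smul, theta_mon]
      congr 1
      refine Finset.prod_congr rfl fun i _ => ?_
      change (α (n + r.toAdd + i - r.toAdd) : k) = _
      congr 2
      ring
    exact CoalgEquiv.ext (LinearMap.congr_fun this)

theorem monomialHom_apply (x : (ℤ → kˣ) ⋊[shiftAction] Multiplicative ℤ) (h : H q) :
    monomialHom q x h = phiAlpha q x.left (theta q x.right.toAdd h) := rfl

theorem monomialHom_mon (x : (ℤ → kˣ) ⋊[shiftAction] Multiplicative ℤ) (n : ℤ) (m : ℕ) :
    monomialHom q x (mon q n m) =
      runProd x.left (n + x.right.toAdd) m • mon q (n + x.right.toAdd) m := by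
  rw [monomialHom_apply, theta_mon, phiAlpha_mon]

/-! ### Conjugation of `bigPhi` by the monomial automorphisms -/

theorem theta_comp_phiS (r : ℤ) (s : ℕ) (β : ℤ → k) :
    theta q r ∘ₗ phiS q s β = phiS q s (fun n => β (n - r)) ∘ₗ theta q r := by
  refine ext_mon q fun n m => ?_
  rw [LinearMap.comp_apply, LinearMap.comp_apply, theta_mon, phiS, ofMon_mon, phiS, ofMon_mon,
    map_add, map_sum, theta_mon]
  congr 1
  refine Finset.sum_congr rfl fun i _ => ?_
  have h1 : ∀ l, stepProd (fun n => β (n - r)) (n + r) s l = stepProd β n s l := by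
    intro l
    refine Finset.prod_congr rfl fun j _ => congrArg β ?_
    ring
  rw [map_smul, map_sub, map_smul, map_smul, theta_mon, theta_mon, h1, h1]
  rw [add_right_comm n r, add_right_comm n r, add_right_comm n r, add_sub_right_comm _ r,
    add_sub_cancel_right]

theorem phiAlpha_comp_phiS (α : ℤ → kˣ) (s : ℕ) (β : ℤ → k) :
    phiAlpha q α ∘ₗ phiS q s β =
      phiS q s (fun n => (runProd α n s)⁻¹ * β n) ∘ₗ phiAlpha q α := by
  set β' : ℤ → k := fun n => (runProd α n s)⁻¹ * β n with hβ'
  have hβ : ∀ n, β' n * runProd α n s = β n := fun n => by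
    have := runProd_ne_zero α n s
    rw [hβ']
    field_simp
  have hstep : ∀ n l, stepProd β' n s l * runProd α n (l * s) = stepProd β n s l := by
    intro n l
    induction l with
    | zero => simp [stepProd, runProd]
    | succ l ih =>
      have h := hβ (n + l * s)
      have e1 : stepProd β n s (l + 1) = stepProd β n s l * β (n + l * s) :=
        Finset.prod_range_succ _ _
      have e2 : stepProd β' n s (l + 1) = stepProd β' n s l * β' (n + l * s) :=
        Finset.prod_range_succ _ _
      rw [e1, e2, ← ih, ← h, add_mul, one_mul, runProd_add]
      push_cast
      ring
  refine ext_mon q fun n m => ?_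
  rw [LinearMap.comp_apply, LinearMap.comp_apply, phiAlpha_mon, map_smul, phiS, ofMon_mon, phiS,
    ofMon_mon, map_add, map_sum, phiAlpha_mon, smul_add, Finset.smul_sum]
  congr 1
  refine Finset.sum_congr rfl fun i hi => ?_
  have him : (i + 1) * s ≤ m :=
    (Nat.mul_le_mul_right s (Finset.mem_range.1 hi)).trans (Nat.div_mul_le_self m s)
  obtain ⟨j, rfl⟩ := Nat.exists_eq_add_of_le him
  rw [Nat.add_sub_cancel_left, map_smul, map_sub, map_smul, map_smul, phiAlpha_mon, phiAlpha_mon,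
    smul_comm (runProd _ _ _) (qBinomProd _ _ _ _)]
  simp only [smul_sub, smul_smul]
  congr 3
  · rw [← hstep, runProd_add]
    push_cast
    ring
  · have h1 : n + (((i + 1) * s + j : ℕ) : ℤ) - s = n + (i * s : ℕ) + j := by push_cast; ring
    rw [← hstep, h1, ← hβ, show (i + 1) * s + j = i * s + j + s by ring, runProd_add, runProd_add]
    push_cast
    rw [add_assoc n]
    ring

theorem monomialHom_bigPhi (x : (ℤ → kˣ) ⋊[shiftAction] Multiplicative ℤ) (β : GInf k) (h : H q) :
    monomialHom q x (bigPhi q β h) =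
      bigPhi q (actFun x.left x.right.toAdd β) (monomialHom q x h) := by
  set γ := actFun x.left x.right.toAdd β
  set T : H q →ₗ[k] H q := phiAlpha q x.left ∘ₗ theta q x.right.toAdd
  have hcomp : ∀ m, T ∘ₗ phiComp q β m = phiComp q γ m ∘ₗ T := by
    intro m
    induction m with
    | zero => rfl
    | succ m ih =>
      have hγ : γ m.succPNat = fun n => (runProd x.left n (m + 1))⁻¹ *
          β m.succPNat (n - x.right.toAdd) := funext fun n => by
        rw [← runProd_inv]
        rfl
      rw [phiComp, phiComp, ← LinearMap.comp_assoc, ih, LinearMap.comp_assoc, LinearMap.comp_assoc,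
        LinearMap.comp_assoc, theta_comp_phiS, ← LinearMap.comp_assoc (theta q _),
        phiAlpha_comp_phiS, hγ, LinearMap.comp_assoc]
  suffices T ∘ₗ bigPhi q β = bigPhi q γ ∘ₗ T from LinearMap.congr_fun this h
  refine ext_mon q fun n m => ?_
  have hT : T (mon q n m) =
    runProd x.left (n + x.right.toAdd) m • mon q (n + x.right.toAdd) m := monomialHom_mon q x n m
  change T (bigPhi q β (mon q n m)) = bigPhi q γ (T (mon q n m))
  rw [bigPhi_mon, hT, map_smul, bigPhi_mon, ← map_smul, ← hT]
  exact LinearMap.congr_fun (hcomp m) _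

variable {q} (hq : ∀ n : ℕ, 0 < n → (q : k) ^ n ≠ 1)
include hq

theorem bigPhiAut_actFun (x : (ℤ → kˣ) ⋊[shiftAction] Multiplicative ℤ) (β : GInf k) :
    bigPhiAut q hq (actFun x.left x.right.toAdd β) =
      monomialHom q x * bigPhiAut q hq β * (monomialHom q x)⁻¹ := by
  rw [eq_mul_inv_iff_mul_eq]
  exact CoalgEquiv.ext fun h => (monomialHom_bigPhi q x β h).symm

omit hq in
variable (q) in
/-- The action of `(kˣ)^ℤ ⋊ ℤ` on `GInf`; it corresponds to conjugation in `AutC`. -/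
def gInfAct (hq : ∀ n : ℕ, 0 < n → (q : k) ^ n ≠ 1) :
    letI := gInfGroup q hq
    ((ℤ → kˣ) ⋊[shiftAction] Multiplicative ℤ) →* MulAut (GInf k) :=
  letI := gInfGroup q hq
  have hmul : ∀ β γ : GInf k, bigPhiAut q hq (β * γ) = bigPhiAut q hq β * bigPhiAut q hq γ :=
    map_mul (gInfHom q hq)
  { toFun := fun x =>
      { toFun := actFun x.left x.right.toAdd
        invFun := actFun (x⁻¹).left (x⁻¹).right.toAdd
        left_inv := fun β => bigPhiAut_injective hq (by
          rw [bigPhiAut_actFun, bigPhiAut_actFun, map_inv]; group)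
        right_inv := fun β => bigPhiAut_injective hq (by
          rw [bigPhiAut_actFun, bigPhiAut_actFun, map_inv]; group)
        map_mul' := fun β γ => bigPhiAut_injective hq (by
          rw [bigPhiAut_actFun, hmul, hmul, bigPhiAut_actFun, bigPhiAut_actFun]; group) }
    map_one' := MulEquiv.ext fun β => bigPhiAut_injective hq (by
      change bigPhiAut q hq (actFun (1 : (ℤ → kˣ) ⋊[shiftAction] Multiplicative ℤ).left
        (1 : (ℤ → kˣ) ⋊[shiftAction] Multiplicative ℤ).right.toAdd β) = bigPhiAut q hq β
      rw [bigPhiAut_actFun, map_one]; group)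
    map_mul' := fun x y => MulEquiv.ext fun β => bigPhiAut_injective hq (by
      change bigPhiAut q hq (actFun (x * y).left (x * y).right.toAdd β) = bigPhiAut q hq
        (actFun x.left x.right.toAdd (actFun y.left y.right.toAdd β))
      rw [bigPhiAut_actFun, bigPhiAut_actFun, bigPhiAut_actFun, map_mul]; group) }

/-! ### Decomposition of the coalgebra automorphisms -/

/-- A coalgebra automorphism shifts the powers of `x`: it permutes them, and the permutation is
strictly increasing, since `φ (xⁿ y)` has a nonzero component at the interval between the images
of `n` and `n + 1`. -/
theorem exists_shift (φ : AutC q) : ∃ r : ℤ, ∀ n, φ (mon q n 0) = mon q (n + r) 0 := by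
  choose σ hσ using exists_apply_mon_zero hq φ
  have hmono : StrictMono σ := strictMono_int_of_lt_succ fun n => by
    obtain ⟨_, _, _, hlt, _⟩ := apply_mon_one hq φ (hσ n) (hσ (n + 1))
    exact hlt
  have hsurj : ∀ m, ∃ n, σ n = m := by
    intro m
    obtain ⟨n, hn⟩ := exists_apply_mon_zero hq φ⁻¹ m
    refine ⟨n, mon_zero_injective q ?_⟩
    change mon q (σ n) 0 = mon q m 0
    rw [← hσ, ← hn]
    exact φ.apply_symm_apply _
  have hstep : ∀ n, σ (n + 1) = σ n + 1 := by
    intro n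
    obtain ⟨m, hm⟩ := hsurj (σ n + 1)
    have h1 : n < m := hmono.lt_iff_lt.1 (by omega)
    have h2 : σ (n + 1) ≤ σ m := hmono.monotone h1
    have h3 : σ n < σ (n + 1) := hmono (by omega)
    omega
  refine ⟨σ 0, fun n => ?_⟩
  have : σ n = n + σ 0 := by
    induction n with
    | zero => simp
    | succ i ih => rw [hstep, ih]; ring
    | pred i ih =>
      have := hstep (-i - 1)
      rw [sub_add_cancel] at this
      omega
  rw [hσ, this]

theorem exists_mul_inv_mem_autStar (φ : AutC q) {r : ℤ}
    (hr : ∀ n, φ (mon q n 0) = mon q (n + r) 0) :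
    ∃ α : ℤ → kˣ, φ * (monomialHom q ⟨α, Multiplicative.ofAdd r⟩)⁻¹ ∈ AutStar q := by
  have h1 : ∀ n, ∃ (c : kˣ) (d : k), φ (mon q (n - r) 1) =
      (c : k) • mon q n 1 + d • (mon q (n + 1) 0 - mon q n 0) := by
    intro n
    have ha : φ (mon q (n - r) 0) = mon q n 0 := by rw [hr, sub_add_cancel]
    have hb : φ (mon q (n - r + 1) 0) = mon q (n + 1) 0 := by rw [hr]; congr 1; ring
    obtain ⟨c, d, hc, -, h⟩ := apply_mon_one hq φ ha hb
    exact ⟨Units.mk0 c hc, d, by rw [h, E_succ]; rfl⟩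
  choose α d hα using h1
  set T := monomialHom q ⟨α, Multiplicative.ofAdd r⟩ with hT
  have hmul : ∀ h, (φ * T⁻¹) (T h) = φ h := fun h => by
    rw [AutC.mul_apply, AutC.inv_apply_self]
  refine ⟨α, ?_, fun n => ((α n)⁻¹ : kˣ) * d n, fun n => ?_⟩
  · have h2 : T (mon q (-r) 0) = 1 := by
      rw [hT, monomialHom_mon]
      simp [runProd, mon_zero_zero]
    change (φ * T⁻¹) 1 = 1
    rw [← h2, hmul, hr, h2, neg_add_cancel, mon_zero_zero]
  · have h2 : T ((((α n)⁻¹ : kˣ) : k) • mon q (n - r) 1) = mon q n 1 := by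
      rw [map_smul, hT, monomialHom_mon]
      simp [runProd]
    nth_rewrite 1 [← h2]
    rw [hmul, map_smul, hα, smul_add, smul_smul, smul_smul]
    simp

/-- The monomial automorphisms meet `AutStar` trivially. -/
theorem eq_one_of_monomialHom_mem {x : (ℤ → kˣ) ⋊[shiftAction] Multiplicative ℤ}
    (hx : monomialHom q x ∈ AutStar q) : x = 1 := by
  have h0 := apply_mon_zero_of_mem_autStar hq hx 0
  obtain ⟨-, β, hβ⟩ := hx
  obtain ⟨α, r⟩ := x
  rw [monomialHom_mon] at h0
  have hr : r.toAdd = 0 := by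
    have : mon q (0 + r.toAdd) 0 = mon q 0 0 := by simpa [runProd] using h0
    simpa using mon_zero_injective q this
  have hα : ∀ n, α n = 1 := by
    intro n
    have h1 := congrArg (coef q n (n + 1)) (hβ n)
    rw [monomialHom_mon, ← E_succ] at h1
    simpa [hr, runProd, coef_E hq, coef_mon_zero hq, ← E_succ] using h1
  exact SemidirectProduct.ext (funext hα) hr

end

section

variable {q : kˣ} (hq : ∀ n : ℕ, 0 < n → (q : k) ^ n ≠ 1)
include hq

/-! ### The semidirect products -/

section

variable [Group (GInf k)] {Φ : GInf k →* AutC q} (hΦ : ∀ g, Φ g = bigPhiAut q hq g)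
include hΦ

theorem eq_one_of_mul_monomialHom {g : GInf k}
    {x : (ℤ → kˣ) ⋊[shiftAction] Multiplicative ℤ} (h : Φ g * monomialHom q x = 1) :
    g = 1 ∧ x = 1 := by
  obtain rfl : x = 1 := by
    refine eq_one_of_monomialHom_mem hq ?_
    rw [eq_inv_of_mul_eq_one_right h, hΦ]
    exact (autStarSubgroup hq).inv_mem (bigPhiAut_mem_autStar hq g)
  rw [map_one, mul_one, ← map_one Φ, hΦ, hΦ] at h
  exact ⟨bigPhiAut_injective hq h, rfl⟩

theorem exists_mul_monomialHom_eq (φ : AutC q) {r : ℤ}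
    (hr : ∀ n, φ (mon q n 0) = mon q (n + r) 0) :
    ∃ g α, Φ g * monomialHom q ⟨α, Multiplicative.ofAdd r⟩ = φ := by
  obtain ⟨α, hα⟩ := exists_mul_inv_mem_autStar hq φ hr
  obtain ⟨g, hg⟩ := exists_bigPhiAut_eq hq hα
  exact ⟨g, α, by rw [hΦ, hg, inv_mul_cancel_right]⟩

variable {act : ((ℤ → kˣ) ⋊[shiftAction] Multiplicative ℤ) →* MulAut (GInf k)}
  (hact : ∀ x g, Φ (act x g) = monomialHom q x * Φ g * (monomialHom q x)⁻¹)
include hact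

theorem exists_mulEquiv_autC :
    ∃ F : (GInf k ⋊[act] ((ℤ → kˣ) ⋊[shiftAction] Multiplicative ℤ)) ≃* AutC q,
      ∀ y, F y = Φ y.left * monomialHom q y.right := by
  let f : GInf k ⋊[act] ((ℤ → kˣ) ⋊[shiftAction] Multiplicative ℤ) →* AutC q :=
    SemidirectProduct.lift Φ (monomialHom q) fun x => MonoidHom.ext (hact x)
  refine ⟨MulEquiv.ofBijective f ⟨?_, ?_⟩, fun _ => rfl⟩
  · rw [injective_iff_map_eq_one]
    intro y h
    obtain ⟨h1, h2⟩ := eq_one_of_mul_monomialHom hq hΦ h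
    exact SemidirectProduct.ext h1 h2
  · intro φ
    obtain ⟨r, hr⟩ := exists_shift hq φ
    obtain ⟨g, α, h⟩ := exists_mul_monomialHom_eq hq hΦ φ hr
    exact ⟨⟨g, ⟨α, Multiplicative.ofAdd r⟩⟩, h⟩

theorem exists_mulEquiv_aut0 :
    ∃ F₀ : (GInf k ⋊[act.comp SemidirectProduct.inl] (ℤ → kˣ)) ≃* Aut0 q,
      ∀ y, (F₀ y : AutC q) = Φ y.left * phiAlphaHom q y.right := by
  have hinl : ∀ α, monomialHom q (SemidirectProduct.inl α) = phiAlphaHom q α :=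
    SemidirectProduct.lift_inl _ _ _
  let f : GInf k ⋊[act.comp SemidirectProduct.inl] (ℤ → kˣ) →* AutC q :=
    SemidirectProduct.lift Φ (phiAlphaHom q) fun α => MonoidHom.ext fun g => by
      rw [← hinl]
      exact hact _ g
  have hf : ∀ y, f y ∈ Aut0 q := by
    intro y
    refine (Aut0 q).mul_mem ?_ ?_
    · rw [hΦ]
      exact (bigPhiAut_mem_autStar hq _).1
    · change phiAlpha q y.right 1 = 1
      rw [← mon_zero_zero, phiAlpha_mon]
      simp [runProd]
  refine ⟨MulEquiv.ofBijective (f.codRestrict (Aut0 q) hf) ⟨?_, ?_⟩, fun _ => rfl⟩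
  · rw [injective_iff_map_eq_one]
    intro y h
    have h' : Φ y.left * phiAlphaHom q y.right = 1 := congrArg Subtype.val h
    rw [← hinl] at h'
    obtain ⟨h1, h2⟩ := eq_one_of_mul_monomialHom hq hΦ h'
    exact SemidirectProduct.ext h1 (congrArg SemidirectProduct.left h2)
  · rintro ⟨φ, hφ⟩
    obtain ⟨r, hr⟩ := exists_shift hq φ
    obtain rfl : r = 0 := by
      have h0 := hr 0
      rw [mon_zero_zero, show φ 1 = 1 from hφ, zero_add, ← mon_zero_zero] at h0
      exact (mon_zero_injective q h0).symm
    obtain ⟨g, α, h⟩ := exists_mul_monomialHom_eq hq hΦ φ hr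
    refine ⟨⟨g, α⟩, Subtype.ext ?_⟩
    change Φ g * phiAlphaHom q α = φ
    rw [← hinl]
    exact h

end

end

end

end QuantumPlane
open QuantumPlane in
theorem theorem3p17 {k : Type*} [Field k] (q : kˣ) (hq : ∀ n : ℕ, 0 < n → (q : k) ^ n ≠ 1) :
    -- a group structure on `G_∞`, given by the recursion
    ∃ _ : Group (GInf k), (∀ β γ : GInf k, IsProduct q β γ (β * γ)) ∧
    -- for which `Φ` is a group isomorphism onto the group `Aut_*`
    ∃ Φ : GInf k →* AutC q, (∀ g h, Φ g h = bigPhi q g h) ∧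
      Function.Injective Φ ∧ Set.range Φ = AutStar q ∧
    -- an action of `(k^×)^ℤ ⋊ ℤ` on `G_∞` by group automorphisms, given by the formula
    ∃ act : ((ℤ → kˣ) ⋊[shiftAction] Multiplicative ℤ) →* MulAut (GInf k),
      (∀ α r g, act ⟨α, Multiplicative.ofAdd r⟩ g = actFun α r g) ∧
      -- the two isomorphisms
      (∃ F : (GInf k ⋊[act] ((ℤ → kˣ) ⋊[shiftAction] Multiplicative ℤ)) ≃* AutC q,
        ∀ g α r h, F ⟨g, ⟨α, Multiplicative.ofAdd r⟩⟩ h =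
          Φ g (phiAlpha q α (theta q r h))) ∧
      (∃ F₀ : (GInf k ⋊[act.comp SemidirectProduct.inl] (ℤ → kˣ)) ≃* Aut0 q,
        ∀ g α h, (F₀ ⟨g, α⟩ : AutC q) h = Φ g (phiAlpha q α h)) := by
  let _ := gInfGroup q hq
  have hΦ : ∀ g, gInfHom q hq g = bigPhiAut q hq g := gInfHom_apply hq
  obtain ⟨F, hF⟩ := exists_mulEquiv_autC hq hΦ (act := gInfAct q hq) (bigPhiAut_actFun hq)
  obtain ⟨F₀, hF₀⟩ := exists_mulEquiv_aut0 hq hΦ (act := gInfAct q hq) (bigPhiAut_actFun hq)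
  refine ⟨_, fun β γ => isProduct_of_comp hq fun z => ?_, gInfHom q hq, ?_,
    bigPhiAut_injective hq, ?_, gInfAct q hq, ?_, ⟨F, ?_⟩, ⟨F₀, ?_⟩⟩
  · exact DFunLike.congr_fun (map_mul (gInfHom q hq) β γ) z
  · exact fun _ _ => rfl
  · refine Set.Subset.antisymm ?_ fun φ hφ => exists_bigPhiAut_eq hq hφ
    rintro _ ⟨g, rfl⟩
    exact bigPhiAut_mem_autStar hq g
  · exact fun _ _ _ => rfl
  · intro g α r h
    rw [hF]
    rfl
  · intro g α h
    rw [hF₀]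
    rfl
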